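/- Let $\mathbb K$ be an ordinary differential field with derivation $\partial$, and let $\mathcal P(X,U)$ be a system $x_i=P_i(U)$, $i=1,\dots,n$, where $P_i\in\mathbb K\{u_1,\dots,u_{n-1}\}$ has degree at most $1$, not all $P_i$ lie in $\mathbb K$, and every $u_j$ occurs (with some derivative) in some $P_i$. Let ${\rm ID}=\{f\in\mathbb K\{x_1,\dots,x_n\}\mid f(P_1(U),\dots,P_n(U))=0\}$ be its implicit ideal. Write $a_i$ for the constant term of $P_i$ and $F_i=x_i-P_i(U)$. For differential polynomials $f_1,\dots,f_n$ of degree at most $1$ in $u_1,\dots,u_{n-1}$ (over a differential domain) let $o_i$ be the order of $f_i$ in $U$ ($o_i=0$ if no derivative of a $u_j$ occurs), ${\rm ord}(f_i,u_j)$ its order in $u_j$ ($-1$ if $u_j$ does not occur), $N=\sum_i o_i$, $\gamma_j=\min_i(o_i-{\rm ord}(f_i,u_j))$, $\gamma=\sum_j\gamma_j$, and let ${\rm PS}(f_1,\dots,f_n)$ consist of the $\partial^k f_i$ with $0\le k\le N-o_i-\gamma$. Whenever the number $L$ of these polynomials is one more than the number of variables $\partial^k u_j$, $0\le k\le N-\gamma_j-\gamma$,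 the linear complete differential resultant $\partial{\rm CRes}(f_1,\dots,f_n)$ is the determinant of the $L\times L$ matrix whose rows are the coefficients of the elements of ${\rm PS}(f_1,\dots,f_n)$, the columns being indexed by these variables in decreasing order ($\partial^k u_j<\partial^{l}u_m$ iff $k<l$, or $k=l$ and $j<m$), followed by a column for the terms free of $U$. With $o_i,\gamma_j,\gamma,N$ computed for $F_1,\dots,F_n$, let $S$ be the $n\times(n-1)$ leading matrix, whose $(i,j)$ entry is the coefficient of $\partial^{\,o_i-\gamma_{n-j}}u_{n-j}$ in $F_i$ (zero if $o_i<\gamma_{n-j}$). Let $({\rm PS})$ be the ideal generated by ${\rm PS}={\rm PS}(F_1,\dots,F_n)$ in $\mathbb K[x_{ik},u_{jl}\mid 0\le k\le N-o_i-\gamma,\ 0\le l\le N-\gamma_j-\gamma]$, where $x_{ik}=\partial^k x_i$ and $u_{jl}=\partial^l u_j$; the co-order ${\rm c}(B)$ of a linear $B\in\mathbb K\{X\}$ is the largest $c\ge 0$ with $\partial^{c}B\in({\rm PS})$. Let $\phi_1,\dots,\phi_n\in\mathbb K\{U\}$ have degree at most $1$, let $p$ be an indeterminate with $\partial p=0$,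 and put $F_i^\phi=F_i-p\,\phi_i(U)$. Assume that $\partial{\rm CRes}(F_1^\phi,\dots,F_n^\phi)\in\mathbb K\{X\}[p]$ is defined and nonzero, let $D_\phi\ge 0$ be the lowest degree of $p$ in it, and let $A_{D_\phi}\in\mathbb K\{X\}$ be the coefficient of $p^{D_\phi}$. Let $A_\phi$ be the ${\rm ID}$-primitive part of $A_{D_\phi}$: if $A_{D_\phi}=\sum_i\mathcal F_i(x_i-a_i)$ with $\mathcal F_i\in\mathbb K[\partial]$ and $\mathcal L$ is a greatest common left divisor of $\mathcal F_1,\dots,\mathcal F_n$, $\mathcal F_i=\mathcal L\mathcal L_i$, then $A_\phi=\sum_i\mathcal L_i(x_i-a_i)$ (unique up to a nonzero factor in $\mathbb K$). If ${\rm rank}(S)=n-1$ and $D_\phi={\rm c}(A_\phi)$, then ${\rm ID}$ has differential dimension $n-1$ (for every ranking, $\rm ID$ has characteristic sets, and each of them has exactly one element), and $A_\phi(X)=0$ is the implicit equation of $\mathcal P(X,U)$, that is, $A_\phi$ is irreducible and $\{A_\phi\}$ is a characteristic set of ${\rm ID}$ for every ranking. -/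

import Mathlib

open scoped Differential

/-! ### Differential polynomial rings -/

/-- `DiffPoly σ R` is the ring `R{Y}` of differential polynomials in the differential
indeterminates `y_i`, `i : σ`; the variable `(i, k)` stands for the derivative `∂^k y_i`. -/
abbrev DiffPoly (σ R : Type*) [CommRing R] := MvPolynomial (σ × ℕ) R

/-- The `k`-fold derivative `∂^k f` in a differential ring. -/
def iterDeriv {R : Type*} [CommRing R] [Differential R] (k : ℕ) (f : R) : R :=
  (fun g : R => g′)^[k] f

namespace DiffPoly

/-- Application of the derivation of `R` to the coefficients of a polynomial. -/
noncomputable def coeffDerivLinear (τ R : Type*) [CommRing R] [Differential R] :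
    MvPolynomial τ R →ₗ[ℤ] MvPolynomial τ R :=
  AddMonoidHom.toIntLinearMap
    { toFun := fun f => AddMonoidAlgebra.ofCoeff
        (Finsupp.mapRange (fun a : R => a′) (map_zero _) (AddMonoidAlgebra.coeff f))
      map_zero' := by ext; simp [MvPolynomial.coeff]
      map_add' := by intro f g; ext; simp [MvPolynomial.coeff] }

theorem coeffDerivLinear_monomial {τ R : Type*} [CommRing R] [Differential R]
    (s : τ →₀ ℕ) (a : R) :
    coeffDerivLinear τ R (MvPolynomial.monomial s a) = MvPolynomial.monomial s (a′) := by
  classical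
  ext m
  change ((AddMonoidAlgebra.coeff (MvPolynomial.monomial s a)) m)′ = _
  have h : (AddMonoidAlgebra.coeff (MvPolynomial.monomial s a)) m
      = MvPolynomial.coeff m (MvPolynomial.monomial s a) := rfl
  rw [h, MvPolynomial.coeff_monomial, MvPolynomial.coeff_monomial]
  split_ifs <;> simp

/-- Differentiation of the coefficients, as a derivation that kills all variables. -/
noncomputable def coeffDeriv (τ R : Type*) [CommRing R] [Differential R] :
    Derivation ℤ (MvPolynomial τ R) (MvPolynomial τ R) :=
  Derivation.mk' (coeffDerivLinear τ R) (by
    intro f g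
    induction f using MvPolynomial.induction_on' with
    | add p q hp hq => rw [add_mul, map_add, hp, hq, map_add]; simp only [smul_eq_mul]; ring
    | monomial s a =>
      induction g using MvPolynomial.induction_on' with
      | add p q hp hq => rw [mul_add, map_add, hp, hq, map_add]; simp only [smul_eq_mul]; ring
      | monomial t b =>
        rw [MvPolynomial.monomial_mul, coeffDerivLinear_monomial, coeffDerivLinear_monomial,
          coeffDerivLinear_monomial]
        simp only [smul_eq_mul, MvPolynomial.monomial_mul, Derivation.leibniz, map_add]
        rw [add_comm t s])

/-- The derivation of `R{Y}`: it extends the derivation of `R` and sends `∂^k y_i` to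
`∂^(k+1) y_i`. -/
noncomputable instance instDifferential (σ R : Type*) [CommRing R] [Differential R] :
    Differential (MvPolynomial (σ × ℕ) R) where
  deriv := coeffDeriv (σ × ℕ) R +
    (MvPolynomial.mkDerivation R
      (fun v : σ × ℕ => (MvPolynomial.X (v.1, v.2 + 1) : MvPolynomial (σ × ℕ) R))).restrictScalars ℤ

/-- The derivation of `R[p]` that extends the derivation of `R` and satisfies `∂ p = 0`. -/
noncomputable instance instDifferentialPolynomial (R : Type*) [CommRing R] [Differential R] :
    Differential (Polynomial R) where
  deriv := Differential.mapCoeffs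

/-- The order `ord(f, y_j)`: the largest `k` such that `∂^k y_j` occurs in `f`, and `-1` if no
derivative of `y_j` occurs. -/
noncomputable def ord {r : ℕ} {R : Type*} [CommRing R] (f : DiffPoly (Fin r) R) (j : Fin r) : ℤ :=
  (((f.vars.filter (fun v => v.1 = j)).sup (fun v => v.2 + 1) : ℕ) : ℤ) - 1

/-- The order of `f`: the largest `k` such that some `∂^k y_j` occurs in `f`, and `0` if `f` is
an element of `R`. -/
noncomputable def order {r : ℕ} {R : Type*} [CommRing R] (f : DiffPoly (Fin r) R) : ℕ :=
  f.vars.sup (fun v => v.2)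

/-- The coefficient of `∂^k y_j` in `f`. -/
noncomputable def varCoeff {r : ℕ} {R : Type*} [CommRing R] (f : DiffPoly (Fin r) R)
    (j : Fin r) (k : ℕ) : R :=
  MvPolynomial.coeff (Finsupp.single (j, k) 1) f

end DiffPoly

/-! ### Linear complete differential resultants -/

namespace DiffRes

open DiffPoly

/-- `N = ∑ o_i`. -/
noncomputable def N {n r : ℕ} {R : Type*} [CommRing R] (f : Fin n → DiffPoly (Fin r) R) : ℕ :=
  ∑ i, order (f i)

/-- `γ_j = min_i (o_i - ord(f_i, u_j))`. -/
noncomputable def gammaAt {n r : ℕ} {R : Type*} [CommRing R] (f : Fin n → DiffPoly (Fin r) R)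
    (j : Fin r) : ℕ :=
  ⨅ i, ((order (f i) : ℤ) - ord (f i) j).toNat

/-- The completeness index `γ = ∑ γ_j`. -/
noncomputable def gamma {n r : ℕ} {R : Type*} [CommRing R] (f : Fin n → DiffPoly (Fin r) R) : ℕ :=
  ∑ j, gammaAt f j

/-- `N - o_i - γ + 1`, the number of derivatives `∂^k f_i`, `0 ≤ k ≤ N - o_i - γ`. -/
noncomputable def numRows {n r : ℕ} {R : Type*} [CommRing R] (f : Fin n → DiffPoly (Fin r) R)
    (i : Fin n) : ℕ :=
  N f + 1 - order (f i) - gamma f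

/-- `L = ∑ (N - o_i - γ + 1)`, the number of polynomials in `PS(f_1, …, f_n)`. -/
noncomputable def L {n r : ℕ} {R : Type*} [CommRing R] (f : Fin n → DiffPoly (Fin r) R) : ℕ :=
  ∑ i, numRows f i

/-- The set `𝒱` of the variables `u_{jk}`, `0 ≤ k ≤ N - γ_j - γ`; the variable `u_{jk}` is
represented by the pair `(k, j)`, ordered lexicographically, so that the order is the orderly
ranking with `u_1 < u_2 < ⋯`. -/
noncomputable def varSet {n r : ℕ} {R : Type*} [CommRing R] (f : Fin n → DiffPoly (Fin r) R) :
    Finset (ℕ ×ₗ Fin r) :=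
  ((Finset.range (N f + 1) ×ˢ (Finset.univ : Finset (Fin r))).filter
    (fun v => v.1 + gammaAt f v.2 + gamma f ≤ N f)).map (toLex : ℕ × Fin r ≃ ℕ ×ₗ Fin r).toEmbedding

/-- The variables in `𝒱` in decreasing order. -/
noncomputable def varList {n r : ℕ} {R : Type*} [CommRing R] (f : Fin n → DiffPoly (Fin r) R) :
    List (ℕ ×ₗ Fin r) :=
  (varSet f).sort (fun a b => b ≤ a)

/-- The complete differential resultant matrix `M(L)`. Its rows correspond to
`∂^{m_1} f_1, …, f_1, ∂^{m_2} f_2, …, f_2, …, ∂^{m_n} f_n, …, f_n`, where `m_i = N - o_i - γ`;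
the first columns contain the coefficients of the variables in `𝒱`, in decreasing order, the
last one the terms of degree zero. -/
noncomputable def matrix {n r : ℕ} {R : Type*} [CommRing R] [Differential R]
    (f : Fin n → DiffPoly (Fin r) R) : Matrix (Fin (L f)) (Fin (L f)) R :=
  Matrix.of fun a b =>
    let ik := finSigmaFinEquiv.symm a
    let g := iterDeriv (numRows f ik.1 - 1 - (ik.2 : ℕ)) (f ik.1)
    match (varList f)[(b : ℕ)]? with
    | some v => varCoeff g (ofLex v).2 (ofLex v).1
    | none => MvPolynomial.constantCoeff g

/-- The linear complete differential resultant `∂CRes(f_1, …, f_n) = det M(L)`. It is the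
resultant of `L` polynomials of degree at most `1` in `L - 1` variables; it is set to `0` if
the number of variables is not `L - 1` (this can only happen when `γ > N - o_i` for some `i`). -/
noncomputable def cRes {n r : ℕ} {R : Type*} [CommRing R] [Differential R]
    (f : Fin n → DiffPoly (Fin r) R) : R :=
  if (varSet f).card + 1 = L f then (matrix f).det else 0

end DiffRes

/-! ### Rings of differential operators -/

/-- The ring `K[∂]` of differential operators `∑ a_k ∂^k`; the operator is the family of its
coefficients. -/
abbrev DiffOp (K : Type*) [Zero K] := ℕ →₀ K

namespace DiffOp

/-- The action `f ↦ ∑ a_k ∂^k f` of an operator on differential polynomials. -/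
noncomputable def act {σ K : Type*} [CommRing K] [Differential K] (P : DiffOp K)
    (f : DiffPoly σ K) : DiffPoly σ K :=
  P.sum fun k a => MvPolynomial.C a * iterDeriv k f

/-- Left multiplication by `∂` in `K[∂]`: `∂ (b ∂^l) = b ∂^(l+1) + b′ ∂^l`. -/
noncomputable def derivMul {K : Type*} [CommRing K] [Differential K] (Q : DiffOp K) : DiffOp K :=
  Q.mapDomain (fun l => l + 1) + Q.mapRange (fun b : K => b′) (map_zero _)

/-- The (noncommutative) product of `K[∂]`: `(∑ a_k ∂^k) Q = ∑ a_k (∂^k Q)`. -/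
noncomputable def mul {K : Type*} [CommRing K] [Differential K] (P Q : DiffOp K) : DiffOp K :=
  P.sum fun k a => a • derivMul^[k] Q

/-- `P` is a left divisor of `Q`. -/
def LeftDvd {K : Type*} [CommRing K] [Differential K] (P Q : DiffOp K) : Prop :=
  ∃ G : DiffOp K, Q = mul P G

/-- `P` is a greatest common left divisor of the family `Q`. -/
def IsGCLD {ι K : Type*} [CommRing K] [Differential K] (P : DiffOp K) (Q : ι → DiffOp K) : Prop :=
  (∀ i, LeftDvd P (Q i)) ∧ ∀ G : DiffOp K, (∀ i, LeftDvd G (Q i)) → LeftDvd G P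

end DiffOp

/-! ### Characteristic sets -/

/-- `r` (read `r u v` as `u < v`) is a ranking of the derivatives `∂^k y_i`. -/
structure IsRanking {σ : Type*} (r : σ × ℕ → σ × ℕ → Prop) : Prop where
  irrefl : ∀ u, ¬ r u u
  trans : ∀ u v w, r u v → r v w → r u w
  trichotomous : ∀ u v, r u v ∨ u = v ∨ r v u
  lt_deriv : ∀ i k, r (i, k) (i, k + 1)
  deriv_lt_deriv : ∀ i k j l, r (i, k) (j, l) → r (i, k + 1) (j, l + 1)

namespace CharSet

/-- `v` is the leader (the highest derivative present) of `f`. -/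
def IsLeader {σ K : Type*} [CommRing K] (r : σ × ℕ → σ × ℕ → Prop) (f : DiffPoly σ K)
    (v : σ × ℕ) : Prop :=
  v ∈ f.vars ∧ ∀ w ∈ f.vars, w = v ∨ r w v

/-- `f` has lower rank than `g`, for `f` and `g` that are not constant. -/
def RankLT {σ K : Type*} [CommRing K] (r : σ × ℕ → σ × ℕ → Prop) (f g : DiffPoly σ K) : Prop :=
  ∃ u v, IsLeader r f u ∧ IsLeader r g v ∧
    (r u v ∨ (u = v ∧ MvPolynomial.degreeOf u f < MvPolynomial.degreeOf u g))

/-- `g` is reduced with respect to `f`: it contains no proper derivative of the leader of `f`,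
and its degree in that leader is smaller than the degree of `f`. -/
def IsReduced {σ K : Type*} [CommRing K] (r : σ × ℕ → σ × ℕ → Prop) (g f : DiffPoly σ K) : Prop :=
  ∀ v, IsLeader r f v →
    (∀ k, v.2 < k → (v.1, k) ∉ g.vars) ∧
      MvPolynomial.degreeOf v g < MvPolynomial.degreeOf v f

/-- An autoreduced set of differential polynomials, listed by increasing rank. -/
def IsAutoreduced {σ K : Type*} [CommRing K] (r : σ × ℕ → σ × ℕ → Prop)
    (l : List (DiffPoly σ K)) : Prop :=
  (∀ f ∈ l, f ∉ Set.range (MvPolynomial.C : K → DiffPoly σ K)) ∧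
    l.Pairwise (fun f g => RankLT r f g ∧ IsReduced r f g ∧ IsReduced r g f)

/-- The comparison of autoreduced sets by rank: `A` is lower than `B` if, at the first place
where the ranks differ, `A` has the lower one, or if `A` properly extends, as a sequence of
ranks, the whole of `B`. -/
def ChainLT {σ K : Type*} [CommRing K] (r : σ × ℕ → σ × ℕ → Prop) :
    List (DiffPoly σ K) → List (DiffPoly σ K) → Prop
  | [], _ => False
  | _ :: _, [] => True
  | f :: A, g :: B => RankLT r f g ∨ (¬ RankLT r f g ∧ ¬ RankLT r g f ∧ ChainLT r A B)

/-- `l` is a characteristic set of the ideal `I` for the ranking `r`: an autoreduced set of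
lowest rank among those contained in `I`. -/
def IsCharSet {σ K : Type*} [CommRing K] (r : σ × ℕ → σ × ℕ → Prop) (I : Ideal (DiffPoly σ K))
    (l : List (DiffPoly σ K)) : Prop :=
  (IsAutoreduced r l ∧ ∀ f ∈ l, f ∈ I) ∧
    ∀ l', IsAutoreduced r l' → (∀ f ∈ l', f ∈ I) → ¬ ChainLT r l' l

/-- The differential dimension of the ideal `I` of `K{x_1, …, x_n}` is `d`: whatever the
ranking, `I` has characteristic sets and `d = n - |C|` for every characteristic set `C`. -/
def HasDimension {n : ℕ} {K : Type*} [CommRing K] (I : Ideal (DiffPoly (Fin n) K)) (d : ℕ) :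
    Prop :=
  ∀ r : Fin n × ℕ → Fin n × ℕ → Prop, IsRanking r →
    (∃ C, IsCharSet r I C) ∧ ∀ C, IsCharSet r I C → (d : ℤ) = (n : ℤ) - (C.length : ℤ)

/-- `A` is a characteristic polynomial of `I`: it is irreducible and `{A}` is a characteristic
set of `I`, whatever the ranking. -/
def IsCharPoly {n : ℕ} {K : Type*} [CommRing K] (I : Ideal (DiffPoly (Fin n) K))
    (A : DiffPoly (Fin n) K) : Prop :=
  Irreducible A ∧ ∀ r : Fin n × ℕ → Fin n × ℕ → Prop, IsRanking r → IsCharSet r I [A]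

end CharSet

/-! ### Systems of linear differential polynomial parametric equations -/

/-- A system `x_i = P_i(U)`, `i = 1, …, n`, of linear differential polynomial parametric
equations over `K` in `n - 1` differential parameters. -/
structure LinearDPPE (n : ℕ) (K : Type*) [CommRing K] where
  P : Fin n → DiffPoly (Fin (n - 1)) K
  totalDegree_le : ∀ i, (P i).totalDegree ≤ 1
  exists_nonconstant : ∃ i, P i ∉ Set.range (MvPolynomial.C : K → DiffPoly (Fin (n - 1)) K)
  exists_ord_nonneg : ∀ j, ∃ i, 0 ≤ DiffPoly.ord (P i) j

namespace LinearDPPE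

open DiffPoly DiffRes

/-- The constant term `a_i` of `P_i`. -/
noncomputable def a {n : ℕ} {K : Type*} [CommRing K] (S : LinearDPPE n K) (i : Fin n) : K :=
  MvPolynomial.constantCoeff (S.P i)

/-- `F_i(X, U) = x_i - P_i(U)`, as an element of `K{X}{U} = K{X ∪ U}`. -/
noncomputable def F {n : ℕ} {K : Type*} [CommRing K] (S : LinearDPPE n K) (i : Fin n) :
    DiffPoly (Fin (n - 1)) (DiffPoly (Fin n) K) :=
  MvPolynomial.C (MvPolynomial.X (i, 0)) - MvPolynomial.map MvPolynomial.C (S.P i)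

/-- The homogeneous differential polynomial `H_i(U)` with `F_i = x_i - a_i + H_i`. -/
noncomputable def H {n : ℕ} {K : Type*} [CommRing K] (S : LinearDPPE n K) (i : Fin n) :
    DiffPoly (Fin (n - 1)) K :=
  MvPolynomial.C (S.a i) - S.P i

/-- The implicit ideal `ID = {f ∈ K{X} | f(P_1(U), …, P_n(U)) = 0}`. -/
noncomputable def implicitIdeal {n : ℕ} {K : Type*} [CommRing K] [Differential K]
    (S : LinearDPPE n K) : Ideal (DiffPoly (Fin n) K) :=
  RingHom.ker (MvPolynomial.aeval (R := K)
    (fun v : Fin n × ℕ => iterDeriv v.2 (S.P v.1))).toRingHom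

/-- The leading matrix `S`: its entry `(i, j)` is the coefficient of `u_{j', o_i - γ_{j'}}` in
`F_i` (that is, in `H_i`), where `j' = n - j`; it is `0` if `o_i < γ_{j'}`. -/
noncomputable def leadingMatrix {n : ℕ} {K : Type*} [CommRing K] (S : LinearDPPE n K) :
    Matrix (Fin n) (Fin (n - 1)) K :=
  Matrix.of fun i j =>
    if gammaAt S.F j.rev ≤ order (S.F i) then
      varCoeff (S.H i) j.rev (order (S.F i) - gammaAt S.F j.rev)
    else 0

/-- The set `PS = {∂^k F_i | 0 ≤ k ≤ N - o_i - γ}`. -/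
def PS {n : ℕ} {K : Type*} [CommRing K] [Differential K] (S : LinearDPPE n K) :
    Set (DiffPoly (Fin (n - 1)) (DiffPoly (Fin n) K)) :=
  {g | ∃ i k, k + order (S.F i) + gamma S.F ≤ N S.F ∧ g = iterDeriv k (S.F i)}

/-- The ring `K[𝒳][𝒱]`, where `𝒳 = {x_{ik} | 0 ≤ k ≤ N - o_i - γ}` and
`𝒱 = {u_{jk} | 0 ≤ k ≤ N - γ_j - γ}`. -/
noncomputable def psRing {n : ℕ} {K : Type*} [CommRing K] (S : LinearDPPE n K) :
    Subalgebra K (DiffPoly (Fin (n - 1)) (DiffPoly (Fin n) K)) :=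
  Algebra.adjoin K
    ({g | ∃ i k, k + order (S.F i) + gamma S.F ≤ N S.F ∧
        g = MvPolynomial.C (MvPolynomial.X (i, k))} ∪
      {g | ∃ j k, k + gammaAt S.F j + gamma S.F ≤ N S.F ∧ g = MvPolynomial.X (j, k)})

/-- The ideal `(PS)` generated by `PS` in `K[𝒳][𝒱]`. -/
noncomputable def psIdeal {n : ℕ} {K : Type*} [CommRing K] [Differential K]
    (S : LinearDPPE n K) : Ideal S.psRing :=
  Ideal.span {g | (g : DiffPoly (Fin (n - 1)) (DiffPoly (Fin n) K)) ∈ S.PS}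

/-- `c` is the co-order of `B ∈ K{X}` in `(PS)`: the highest `c` with `∂^c B ∈ (PS)`. -/
def IsCoOrder {n : ℕ} {K : Type*} [CommRing K] [Differential K] (S : LinearDPPE n K)
    (B : DiffPoly (Fin n) K) (c : ℕ) : Prop :=
  IsGreatest {k : ℕ | ∃ g ∈ S.psIdeal,
    (g : DiffPoly (Fin (n - 1)) (DiffPoly (Fin n) K)) = MvPolynomial.C (iterDeriv k B)} c

/-- `A` is an `ID`-primitive part of `B ∈ ID`: `B = ∑ 𝓕_i (x_i - a_i)`, the operator `𝓛` is a
greatest common left divisor of the `𝓕_i` (the `ID`-content of `B`), `𝓕_i = 𝓛 𝓛_i`, and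
`A = ∑ 𝓛_i (x_i - a_i)`. -/
def IsPrimitivePart {n : ℕ} {K : Type*} [CommRing K] [Differential K] (S : LinearDPPE n K)
    (B A : DiffPoly (Fin n) K) : Prop :=
  ∃ (FF LL : Fin n → DiffOp K) (cont : DiffOp K),
    B = ∑ i, (FF i).act (MvPolynomial.X (i, 0) - MvPolynomial.C (S.a i)) ∧
    DiffOp.IsGCLD cont FF ∧
    (∀ i, FF i = DiffOp.mul cont (LL i)) ∧
    A = ∑ i, (LL i).act (MvPolynomial.X (i, 0) - MvPolynomial.C (S.a i))

/-- `F_i^φ(X, U) = F_i(X, U) - p φ_i(U)`, as an element of `K{X}[p]{U}` with `∂ p = 0`. -/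
noncomputable def perturbedF {n : ℕ} {K : Type*} [CommRing K] (S : LinearDPPE n K)
    (φ : Fin n → DiffPoly (Fin (n - 1)) K) (i : Fin n) :
    DiffPoly (Fin (n - 1)) (Polynomial (DiffPoly (Fin n) K)) :=
  MvPolynomial.map Polynomial.C (S.F i) -
    MvPolynomial.C Polynomial.X *
      MvPolynomial.map (Polynomial.C.comp MvPolynomial.C) (φ i)

/-- The differential resultant `∂CRes(F_1^φ, …, F_n^φ)` of the perturbed system, as a polynomial
in `p` with coefficients in `K{X}`. -/
noncomputable def perturbedRes {n : ℕ} {K : Type*} [CommRing K] [Differential K]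
    (S : LinearDPPE n K) (φ : Fin n → DiffPoly (Fin (n - 1)) K) :
    Polynomial (DiffPoly (Fin n) K) :=
  cRes (S.perturbedF φ)

/-- The degree `D_φ` of the perturbed system: the lowest degree of `p` in
`∂CRes(F_1^φ, …, F_n^φ)`, and `-1` if this resultant vanishes. -/
noncomputable def degree {n : ℕ} {K : Type*} [CommRing K] [Differential K]
    (S : LinearDPPE n K) (φ : Fin n → DiffPoly (Fin (n - 1)) K) : ℤ :=
  open Classical in
  if S.perturbedRes φ = 0 then -1 else ((S.perturbedRes φ).natTrailingDegree : ℤ)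

/-- `A_{D_φ}`, the coefficient of `p^{D_φ}` in `∂CRes(F_1^φ, …, F_n^φ)`. -/
noncomputable def lowestCoeff {n : ℕ} {K : Type*} [CommRing K] [Differential K]
    (S : LinearDPPE n K) (φ : Fin n → DiffPoly (Fin (n - 1)) K) : DiffPoly (Fin n) K :=
  (S.perturbedRes φ).coeff (S.degree φ).toNat

/-- `A` is a differential polynomial `A_φ` associated to the perturbed system: an `ID`-primitive
part of `A_{D_φ}` (it is unique up to a nonzero factor in `K`). -/
def IsAssociated {n : ℕ} {K : Type*} [CommRing K] [Differential K] (S : LinearDPPE n K)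
    (φ : Fin n → DiffPoly (Fin (n - 1)) K) (A : DiffPoly (Fin n) K) : Prop :=
  S.IsPrimitivePart (S.lowestCoeff φ) A

end LinearDPPE

/-! ### Iterated derivatives and affine forms -/

/-! Two facts about $B = A_{D_\phi}$ are combined: it is a nonzero element of ${\rm ID}$, and when
$S$ has rank $n-1$ the primitive part of any nonzero element of ${\rm ID}$ of the form $\sum_i
\mathcal F_i(x_i-a_i)$ is a characteristic polynomial.

Membership. The substitution $x_i \mapsto P_i + p\,\phi_i$ commutes with $\partial$ and kills every
$F_i^\phi$, hence all rows of the resultant system, hence the determinant (`map_cRes_eq_zero`).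
Cancelling $p^{D_\phi}$ and setting $p = 0$ shows that the lowest coefficient vanishes at $x_i =
P_i$ (`lowestCoeff_mem_implicitIdeal`).

Linear algebra over $\mathbb K[\partial]$. Let $M$ be the matrix of operators with $P_i - a_i =
\sum_j M_{ij}(u_j)$. Then $\sum_i \mathcal F_i(x_i-a_i)$ lies in ${\rm ID}$ iff $(\mathcal F_i)$ is
a left syzygy of $M$ (`linearPoly_mem_implicitIdeal`). Comparing top coefficients, the rank
condition makes some coordinate projection injective on syzygies (`IsSyzygy.eq_zero_of_leading`), so
division with remainder gives a single generator $E$ (`exists_generator`). A syzygy without left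
content is a constant multiple of $E$, so no nonzero syzygy has smaller order in a component
(`IsSyzygy.eq_zero_of_lt`).

From linear to arbitrary elements. A nonzero polynomial of ${\rm ID}$ in a set $W$ of derivatives of
the $x_i$ forces a nonzero syzygy supported on $W$: otherwise the linear parts of the corresponding
$\partial^k P_i$ are independent and the substitution is injective on $\mathbb K[W]$
(`eq_zero_of_vars_subset`). Hence a nonzero element of ${\rm ID}$ cannot avoid a derivative
occurring in $A_\phi$ together with all its higher derivatives, which determines the characteristic
sets for every ranking (`IsMinimalIn`). -/

theorem iterDeriv_zero {R : Type*} [CommRing R] [Differential R] (f : R) : iterDeriv 0 f = f := rfl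

theorem iterDeriv_succ {R : Type*} [CommRing R] [Differential R] (k : ℕ) (f : R) :
    iterDeriv (k + 1) f = (iterDeriv k f)′ :=
  Function.iterate_succ_apply' _ _ _

theorem iterDeriv_map {R T : Type*} [CommRing R] [Differential R] [CommRing T] [Differential T]
    (θ : R →+* T) (hθ : ∀ f, θ (f′) = (θ f)′) (k : ℕ) (f : R) :
    θ (iterDeriv k f) = iterDeriv k (θ f) := by
  induction k with
  | zero => rfl
  | succ k ih => rw [iterDeriv_succ, iterDeriv_succ, hθ, ih]

theorem iterDeriv_add {R : Type*} [CommRing R] [Differential R] (k : ℕ) (f g : R) :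
    iterDeriv k (f + g) = iterDeriv k f + iterDeriv k g := by
  induction k with
  | zero => rfl
  | succ k ih => simp only [iterDeriv_succ, ih, map_add]

theorem iterDeriv_zero_right {R : Type*} [CommRing R] [Differential R] (k : ℕ) :
    iterDeriv k (0 : R) = 0 := by
  induction k with
  | zero => rfl
  | succ k ih => rw [iterDeriv_succ, ih, map_zero]

namespace DiffPoly

open MvPolynomial

theorem deriv_C {σ R : Type*} [CommRing R] [Differential R] (a : R) :
    (C a : MvPolynomial (σ × ℕ) R)′ = C (a′) := by
  change coeffDerivLinear (σ × ℕ) R (monomial 0 a) + mkDerivation R _ (algebraMap R _ a) = _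
  rw [coeffDerivLinear_monomial, Derivation.map_algebraMap, add_zero]
  rfl

theorem deriv_X {σ R : Type*} [CommRing R] [Differential R] (v : σ × ℕ) :
    (X v : MvPolynomial (σ × ℕ) R)′ = X (v.1, v.2 + 1) := by
  change coeffDerivLinear (σ × ℕ) R (monomial _ 1) + mkDerivation R _ (X v) = _
  rw [coeffDerivLinear_monomial, mkDerivation_X]
  simp

theorem deriv_C_mul {σ R : Type*} [CommRing R] [Differential R] (a : R)
    (f : MvPolynomial (σ × ℕ) R) : (C a * f)′ = C a * f′ + C (a′) * f := by
  rw [Derivation.leibniz, deriv_C, smul_eq_mul, smul_eq_mul, mul_comm f]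

theorem iterDeriv_X {σ R : Type*} [CommRing R] [Differential R] (k : ℕ) (i : σ) :
    iterDeriv k (X (i, 0) : MvPolynomial (σ × ℕ) R) = X (i, k) := by
  induction k with
  | zero => rfl
  | succ k ih => rw [iterDeriv_succ, ih, deriv_X]

theorem polynomial_deriv_C {R : Type*} [CommRing R] [Differential R] (a : R) :
    (Polynomial.C a)′ = Polynomial.C (a′) :=
  Differential.mapCoeffs_C a

theorem polynomial_deriv_X {R : Type*} [CommRing R] [Differential R] :
    (Polynomial.X : Polynomial R)′ = 0 :=
  Differential.mapCoeffs_X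

/-- A ring homomorphism out of a differential polynomial ring commutes with the derivations as
soon as it does so on coefficients and variables. -/
theorem map_deriv_of_C_of_X {σ R T : Type*} [CommRing R] [Differential R] [CommRing T]
    [Differential T] (θ : MvPolynomial (σ × ℕ) R →+* T) (hC : ∀ a, θ (C (a′)) = (θ (C a))′)
    (hX : ∀ v : σ × ℕ, θ (X (v.1, v.2 + 1)) = (θ (X v))′) (f : MvPolynomial (σ × ℕ) R) :
    θ (f′) = (θ f)′ := by
  induction f using MvPolynomial.induction_on with
  | C a => rw [deriv_C, hC]
  | add p q hp hq => simp only [map_add, hp, hq]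
  | mul_X p v hp =>
    rw [Derivation.leibniz, map_mul, Derivation.leibniz, deriv_X, map_add]
    simp only [smul_eq_mul, map_mul, hp, hX]

theorem polynomial_map_deriv {R T : Type*} [CommRing R] [Differential R] [CommRing T]
    [Differential T] (θ : Polynomial R →+* T)
    (hC : ∀ a, θ (Polynomial.C (a′)) = (θ (Polynomial.C a))′)
    (hX : (θ Polynomial.X)′ = 0) (f : Polynomial R) : θ (f′) = (θ f)′ := by
  have hXn : ∀ n : ℕ, (θ Polynomial.X ^ n)′ = 0 := fun n => by
    rw [Derivation.leibniz_pow, hX]; simp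
  induction f using Polynomial.induction_on' with
  | add p q hp hq => simp only [map_add, hp, hq]
  | monomial n a =>
    rw [← Polynomial.C_mul_X_pow_eq_monomial, Derivation.leibniz, Derivation.leibniz_pow,
      polynomial_deriv_C, polynomial_deriv_X]
    simp only [smul_zero, smul_eq_mul, MulZeroClass.mul_zero, zero_add, map_mul, map_pow,
      Derivation.leibniz, hXn, hC]

theorem totalDegree_map_le {τ R T : Type*} [CommRing R] [CommRing T] (θ : R →+* T)
    (f : MvPolynomial τ R) : (map θ f).totalDegree ≤ f.totalDegree :=
  Finset.sup_mono (support_map_subset θ f)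

/-- The polynomials of the form `c + ∑ a_v X_v` with `v` in `W`. -/
noncomputable def affineForms {τ : Type*} (R : Type*) [CommRing R] (W : Set τ) :
    Submodule R (MvPolynomial τ R) :=
  Submodule.span R (insert 1 (X '' W))

theorem X_mem_affineForms {τ R : Type*} [CommRing R] {W : Set τ} {v : τ} (hv : v ∈ W) :
    (X v : MvPolynomial τ R) ∈ affineForms R W :=
  Submodule.subset_span (Or.inr ⟨v, hv, rfl⟩)

theorem C_mem_affineForms {τ R : Type*} [CommRing R] (W : Set τ) (a : R) :
    (C a : MvPolynomial τ R) ∈ affineForms R W := by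
  rw [← mul_one (C a), ← smul_eq_C_mul]
  exact Submodule.smul_mem _ _ (Submodule.subset_span (Or.inl rfl))

theorem eq_single_of_degree_le_one {τ : Type*} {s : τ →₀ ℕ} (hs : s.degree ≤ 1) {v : τ}
    (hv : s v ≠ 0) : s = Finsupp.single v 1 := by
  have hadd := add_tsub_cancel_of_le
    (Finsupp.single_le_iff.mpr (Nat.one_le_iff_ne_zero.mpr hv) : Finsupp.single v 1 ≤ s)
  have hd := congrArg Finsupp.degree hadd
  rw [map_add, Finsupp.degree_single] at hd
  have h0 : (s - Finsupp.single v 1).degree = 0 := by omega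
  rw [← hadd, (Finsupp.degree_eq_zero_iff _).mp h0, add_zero]

theorem coeff_single_ne_zero_of_mem_vars {τ R : Type*} [CommRing R] {f : MvPolynomial τ R}
    (hf : f.totalDegree ≤ 1) {v : τ} (hv : v ∈ f.vars) : coeff (Finsupp.single v 1) f ≠ 0 := by
  obtain ⟨s, hs, hvs⟩ := (mem_vars_iff_mem_support v).mp hv
  rw [← eq_single_of_degree_le_one ((le_totalDegree hs).trans hf) (Finsupp.mem_support_iff.mp hvs)]
  exact mem_support_iff.mp hs

theorem mem_affineForms_of_totalDegree_le {τ R : Type*} [CommRing R] {f : MvPolynomial τ R}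
    (hf : f.totalDegree ≤ 1) : f ∈ affineForms R (f.vars : Set τ) := by
  rw [f.as_sum]
  refine Submodule.sum_mem _ fun s hs => ?_
  have hdeg : s.degree ≤ 1 := (le_totalDegree hs).trans hf
  rcases Nat.le_one_iff_eq_zero_or_eq_one.mp hdeg with h | h
  · rw [(Finsupp.degree_eq_zero_iff s).mp h]
    exact C_mem_affineForms _ _
  · obtain ⟨v, hv⟩ : ∃ v, s v ≠ 0 := by
      by_contra! h0
      rw [show s = 0 from Finsupp.ext h0, map_zero] at h
      exact zero_ne_one h
    obtain rfl := eq_single_of_degree_le_one hdeg hv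
    rw [← mul_one (coeff _ f), ← smul_eq_mul, ← smul_monomial]
    refine Submodule.smul_mem _ _ (X_mem_affineForms ?_)
    rw [← f.as_sum]
    exact (mem_vars_iff_mem_support v).mpr ⟨_, hs, by simp⟩

theorem affineForms_mono {τ R : Type*} [CommRing R] {V W : Set τ} (h : V ⊆ W) :
    affineForms R V ≤ affineForms R W :=
  Submodule.span_mono (Set.insert_subset_insert (Set.image_mono h))

/-- The finite set may be larger than the set of variables that occur, so one expansion can run over
all columns of the resultant matrix. -/
theorem eq_sum_of_mem_affineForms {τ R : Type*} [CommRing R] {s : Finset τ} {f : MvPolynomial τ R}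
    (hf : f ∈ affineForms R (s : Set τ)) :
    f = C (constantCoeff f) + ∑ v ∈ s, C (coeff (Finsupp.single v 1) f) * X v := by
  classical
  induction hf using Submodule.span_induction with
  | zero => simp
  | mem g hg =>
    rcases hg with rfl | ⟨w, hw, rfl⟩
    · simp [coeff_one, eq_comm (a := (0 : τ →₀ ℕ))]
    · simp only [constantCoeff_X, map_zero, zero_add, coeff_X, Finsupp.single_left_inj one_ne_zero]
      rw [Finset.sum_eq_single w]
      · simp
      · intro b _ hb; simp [hb.symm]
      · intro h; exact absurd hw h
  | add x y _ _ hx hy =>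
    conv_lhs => rw [hx, hy]
    simp only [map_add, coeff_add, add_mul, Finset.sum_add_distrib]
    ring
  | smul a x _ hx =>
    conv_lhs => rw [hx]
    simp only [smul_eq_C_mul, coeff_C_mul, map_mul, constantCoeff_C, mul_add, Finset.mul_sum,
      mul_assoc]

theorem deriv_mem_affineForms {σ R : Type*} [CommRing R] [Differential R] {V W : Set (σ × ℕ)}
    (hVW : V ⊆ W) (hV : ∀ v ∈ V, (v.1, v.2 + 1) ∈ W) {f : MvPolynomial (σ × ℕ) R}
    (hf : f ∈ affineForms R V) : f′ ∈ affineForms R W := by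
  induction hf using Submodule.span_induction with
  | zero => rw [map_zero]; exact Submodule.zero_mem _
  | mem g hg =>
    rcases hg with rfl | ⟨w, hw, rfl⟩
    · rw [Derivation.map_one_eq_zero]; exact Submodule.zero_mem _
    · rw [deriv_X]; exact X_mem_affineForms (hV w hw)
  | add x y _ _ hx hy => rw [map_add]; exact Submodule.add_mem _ hx hy
  | smul a x hx' hx =>
    rw [smul_eq_C_mul, deriv_C_mul, ← smul_eq_C_mul, ← smul_eq_C_mul]
    exact Submodule.add_mem _ (Submodule.smul_mem _ _ hx)
      (Submodule.smul_mem _ _ (affineForms_mono hVW hx'))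

/-- The homogeneous linear form with the given coefficients. -/
noncomputable def linearForm (τ K : Type*) [CommRing K] : (τ →₀ K) →ₗ[K] MvPolynomial τ K :=
  Finsupp.linearCombination K (X : τ → MvPolynomial τ K)

theorem linearForm_apply {τ K : Type*} [CommRing K] (t : τ →₀ K) :
    linearForm τ K t = t.sum fun v a => C a * X v := by
  simp only [linearForm, Finsupp.linearCombination_apply, smul_eq_C_mul]

theorem coeff_linearForm {τ K : Type*} [CommRing K] (t : τ →₀ K) (v : τ) :
    coeff (Finsupp.single v 1) (linearForm τ K t) = t v := by
  classical
  rw [linearForm_apply, Finsupp.sum, coeff_sum]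
  simp only [coeff_C_mul, coeff_X, Finsupp.single_left_inj one_ne_zero, mul_ite, mul_one,
    mul_zero, Finset.sum_ite_eq', Finsupp.mem_support_iff]
  split_ifs with h
  · rfl
  · exact (not_not.mp h).symm

theorem coeff_single_C {τ R : Type*} [CommRing R] (v : τ) (a : R) :
    coeff (Finsupp.single v 1) (C a : MvPolynomial τ R) = 0 := by
  classical
  rw [coeff_C, if_neg (Finsupp.single_ne_zero.mpr one_ne_zero).symm]

theorem totalDegree_le_of_mem_affineForms {τ R : Type*} [CommRing R] {W : Set τ}
    {f : MvPolynomial τ R} (hf : f ∈ affineForms R W) : f.totalDegree ≤ 1 := by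
  induction hf using Submodule.span_induction with
  | zero => simp
  | mem g hg =>
    rcases hg with rfl | ⟨w, _, rfl⟩
    · simp
    · exact (totalDegree_monomial_le _ _).trans (by simp)
  | add x y _ _ hx hy => exact (totalDegree_add x y).trans (max_le hx hy)
  | smul a x _ hx => exact (totalDegree_smul_le a x).trans hx

theorem exists_eq_C_add_linearForm {τ R : Type*} [CommRing R] {W : Set τ}
    {f : MvPolynomial τ R} (hf : f ∈ affineForms R W) : ∃ b t, f = C b + linearForm τ R t := by
  induction hf using Submodule.span_induction with
  | zero => exact ⟨0, 0, by simp⟩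
  | mem g hg =>
    rcases hg with rfl | ⟨w, _, rfl⟩
    · exact ⟨1, 0, by simp⟩
    · exact ⟨0, Finsupp.single w 1, by simp [linearForm]⟩
  | add x y _ _ hx hy =>
    obtain ⟨b, t, rfl⟩ := hx
    obtain ⟨b', t', rfl⟩ := hy
    exact ⟨b + b', t + t', by rw [map_add, map_add]; ring⟩
  | smul a x _ hx =>
    obtain ⟨b, t, rfl⟩ := hx
    exact ⟨a * b, a • t, by rw [map_smul, smul_add, C_mul, smul_eq_C_mul]⟩

theorem iterDeriv_mem_affineForms {σ R : Type*} [CommRing R] [Differential R]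
    {f : MvPolynomial (σ × ℕ) R} (hf : f ∈ affineForms R Set.univ) (k : ℕ) :
    iterDeriv k f ∈ affineForms R (Set.univ : Set (σ × ℕ)) := by
  induction k with
  | zero => exact hf
  | succ k ih =>
    rw [iterDeriv_succ]
    exact deriv_mem_affineForms subset_rfl (fun _ _ => Set.mem_univ _) ih

/-- A substitution by affine forms with linearly independent linear parts is injective. -/
theorem aeval_injective_of_linearIndependent {ι τ K : Type*} [Field K] (b : ι → K)
    (t : ι → τ →₀ K) (ht : LinearIndependent K t) :
    Function.Injective (aeval (R := K) fun e => C (b e) + linearForm τ K (t e)) := by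
  obtain ⟨g, hg⟩ := (Finsupp.linearCombination K t).exists_leftInverse_of_injective
    (LinearMap.ker_eq_bot.mpr ht)
  -- A left inverse is built in two stages: `back` inverts the linear parts through `g`, and `shift`
  -- then removes the constants `b e`.
  let back : MvPolynomial τ K →ₐ[K] MvPolynomial ι K :=
    aeval fun v => linearForm ι K (g (Finsupp.single v 1))
  have hback : ∀ s : τ →₀ K, back (linearForm τ K s) = linearForm ι K (g s) := by
    intro s
    induction s using Finsupp.induction_linear with
    | zero => simp
    | add x y hx hy => simp only [map_add, hx, hy]
    | single v a =>
      rw [← mul_one a, ← smul_eq_mul, ← Finsupp.smul_single, map_smul, map_smul, map_smul,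
        map_smul]
      simp [linearForm, back]
  have hgt : ∀ e, g (t e) = Finsupp.single e 1 := fun e => by
    have := LinearMap.congr_fun hg (Finsupp.single e 1)
    simpa using this
  let shift : MvPolynomial ι K →ₐ[K] MvPolynomial ι K := aeval fun e => X e - C (b e)
  have key : (shift.comp back).comp (aeval fun e => C (b e) + linearForm τ K (t e))
      = AlgHom.id K _ := by
    refine MvPolynomial.algHom_ext fun e => ?_
    have hbC : back (C (b e)) = C (b e) := algHom_C _ _
    have hsC : shift (C (b e)) = C (b e) := algHom_C _ _
    simp only [AlgHom.comp_apply, aeval_X, map_add, hback, hgt, hbC, hsC, AlgHom.id_apply]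
    simp [linearForm, shift]
  exact Function.LeftInverse.injective (g := shift.comp back) fun f => AlgHom.congr_fun key f

end DiffPoly

/-! ### The ring of differential operators -/

namespace DiffOp

variable {K : Type*} [CommRing K] [Differential K]

theorem derivMul_apply_zero (Q : DiffOp K) : derivMul Q 0 = (Q 0)′ := by
  rw [derivMul, Finsupp.add_apply, Finsupp.mapDomain_of_notMem_range _ _ (by simp), zero_add,
    Finsupp.mapRange_apply]

theorem derivMul_apply_succ (Q : DiffOp K) (l : ℕ) : derivMul Q (l + 1) = Q l + (Q (l + 1))′ := by
  rw [derivMul, Finsupp.add_apply, Finsupp.mapRange_apply,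
    Finsupp.mapDomain_apply (add_left_injective 1) Q l]

theorem derivMul_add (P Q : DiffOp K) : derivMul (P + Q) = derivMul P + derivMul Q := by
  ext l
  cases l with
  | zero => simp [derivMul_apply_zero]
  | succ l => simp only [derivMul_apply_succ, Finsupp.add_apply, map_add]; ring

theorem derivMul_zero : derivMul (0 : DiffOp K) = 0 := by
  ext l
  cases l <;> simp [derivMul_apply_zero, derivMul_apply_succ]

theorem derivMul_smul (a : K) (Q : DiffOp K) : derivMul (a • Q) = a • derivMul Q + a′ • Q := by
  ext l
  cases l with
  | zero => simp [derivMul_apply_zero, mul_comm]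
  | succ l =>
    simp only [derivMul_apply_succ, Finsupp.add_apply, Finsupp.smul_apply, smul_eq_mul,
      Derivation.leibniz]
    ring

theorem derivMul_iterate_add (k : ℕ) (P Q : DiffOp K) :
    derivMul^[k] (P + Q) = derivMul^[k] P + derivMul^[k] Q := by
  induction k with
  | zero => rfl
  | succ k ih => simp only [Function.iterate_succ_apply', ih, derivMul_add]

theorem derivMul_iterate_zero (k : ℕ) : derivMul^[k] (0 : DiffOp K) = 0 := by
  induction k with
  | zero => rfl
  | succ k ih => simp only [Function.iterate_succ_apply', ih, derivMul_zero]

theorem derivMul_single (k : ℕ) (a : K) :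
    derivMul (Finsupp.single k a) = Finsupp.single (k + 1) a + Finsupp.single k (a′) := by
  rw [derivMul, Finsupp.mapDomain_single, Finsupp.mapRange_single]

theorem mul_single (k : ℕ) (a : K) (Q : DiffOp K) :
    mul (Finsupp.single k a) Q = a • derivMul^[k] Q := by
  exact Finsupp.sum_single_index (zero_smul _ _)

theorem zero_mul (Q : DiffOp K) : mul 0 Q = 0 := Finsupp.sum_zero_index

theorem mul_zero (P : DiffOp K) : mul P 0 = 0 := by
  simp [mul, derivMul_iterate_zero]

theorem add_mul (P P' Q : DiffOp K) : mul (P + P') Q = mul P Q + mul P' Q :=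
  Finsupp.sum_add_index' (fun _ => zero_smul _ _) fun _ _ _ => add_smul _ _ _

theorem mul_add (P Q Q' : DiffOp K) : mul P (Q + Q') = mul P Q + mul P Q' := by
  simp only [mul, derivMul_iterate_add, smul_add, Finsupp.sum_add]

theorem smul_mul (a : K) (P Q : DiffOp K) : mul (a • P) Q = a • mul P Q := by
  induction P using Finsupp.induction_linear with
  | zero => rw [smul_zero, zero_mul, smul_zero]
  | add x y hx hy => rw [smul_add, add_mul, add_mul, hx, hy, smul_add]
  | single k b => rw [Finsupp.smul_single, mul_single, mul_single, smul_smul, smul_eq_mul]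

theorem neg_mul (P Q : DiffOp K) : mul (-P) Q = -mul P Q := by
  rw [← neg_one_smul K, smul_mul, neg_one_smul]

theorem sub_mul (P P' Q : DiffOp K) : mul (P - P') Q = mul P Q - mul P' Q := by
  rw [sub_eq_add_neg, add_mul, neg_mul, sub_eq_add_neg]

theorem mul_sum {ι : Type*} (s : Finset ι) (P : DiffOp K) (Q : ι → DiffOp K) :
    mul P (∑ i ∈ s, Q i) = ∑ i ∈ s, mul P (Q i) :=
  map_sum (AddMonoidHom.mk' (mul P) (mul_add P)) Q s

theorem derivMul_mul (P Q : DiffOp K) : derivMul (mul P Q) = mul (derivMul P) Q := by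
  induction P using Finsupp.induction_linear with
  | zero => rw [derivMul_zero, zero_mul, derivMul_zero]
  | add x y hx hy => rw [add_mul, derivMul_add, derivMul_add, add_mul, hx, hy]
  | single k a =>
    rw [mul_single, derivMul_smul, derivMul_single, add_mul, mul_single, mul_single,
      Function.iterate_succ_apply']

theorem derivMul_iterate_mul (k : ℕ) (P Q : DiffOp K) :
    derivMul^[k] (mul P Q) = mul (derivMul^[k] P) Q := by
  induction k with
  | zero => rfl
  | succ k ih => rw [Function.iterate_succ_apply', ih, derivMul_mul, Function.iterate_succ_apply']

theorem mul_assoc (P Q R : DiffOp K) : mul (mul P Q) R = mul P (mul Q R) := by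
  induction P using Finsupp.induction_linear with
  | zero => simp only [zero_mul]
  | add x y hx hy => simp only [add_mul, hx, hy]
  | single k a => rw [mul_single, mul_single, smul_mul, derivMul_iterate_mul]

/-- The operator `P` has order at most `a`. -/
def OrdLE (P : DiffOp K) (a : ℕ) : Prop := ∀ k, a < k → P k = 0

/-- In $\partial\,(b\,\partial^l) = b\,\partial^{l+1} + b'\,\partial^l$ the derivative of the
coefficient only enters below the top, so the top coefficient is carried along unchanged. -/
theorem OrdLE.derivMul_iterate {Q : DiffOp K} {b : ℕ} (hQ : Q.OrdLE b) (k : ℕ) :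
    (derivMul^[k] Q).OrdLE (b + k) ∧ (derivMul^[k] Q) (b + k) = Q b := by
  induction k with
  | zero => exact ⟨hQ, rfl⟩
  | succ k ih =>
    rw [Function.iterate_succ_apply']
    constructor
    · intro m hm
      obtain ⟨m, rfl⟩ : ∃ m', m = m' + 1 := ⟨m - 1, by omega⟩
      rw [derivMul_apply_succ, ih.1 m (by omega), ih.1 (m + 1) (by omega), map_zero, add_zero]
    · rw [← add_assoc, derivMul_apply_succ, ih.2, ih.1 _ (Nat.lt_succ_self _), map_zero, add_zero]

theorem mul_apply (P Q : DiffOp K) (m : ℕ) :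
    mul P Q m = P.sum fun k a => a * (derivMul^[k] Q) m := by
  rw [mul, Finsupp.sum_apply]
  rfl

theorem OrdLE.mul {P Q : DiffOp K} {a b : ℕ} (hP : P.OrdLE a) (hQ : Q.OrdLE b) :
    (mul P Q).OrdLE (a + b) := by
  intro m hm
  rw [mul_apply]
  refine Finset.sum_eq_zero fun k hk => ?_
  have hka : k ≤ a := not_lt.mp fun h => Finsupp.mem_support_iff.mp hk (hP k h)
  dsimp only
  rw [(hQ.derivMul_iterate k).1 m (by omega), MulZeroClass.mul_zero]

/-- Noncommutativity affects only lower terms. Since `a` and `b` are mere bounds on the orders, the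
formula also reads off coefficients that may vanish. -/
theorem OrdLE.mul_apply_add {P Q : DiffOp K} {a b : ℕ} (hP : P.OrdLE a) (hQ : Q.OrdLE b) :
    DiffOp.mul P Q (a + b) = P a * Q b := by
  rw [mul_apply, Finsupp.sum, Finset.sum_eq_single a]
  · rw [add_comm a b, (hQ.derivMul_iterate a).2]
  · intro k hk hka
    have : k ≤ a := not_lt.mp fun h => Finsupp.mem_support_iff.mp hk (hP k h)
    rw [(hQ.derivMul_iterate k).1 (a + b) (by omega), MulZeroClass.mul_zero]
  · intro ha
    rw [Finsupp.notMem_support_iff.mp ha, MulZeroClass.zero_mul]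

theorem exists_top {R : Type*} [CommRing R] {P : DiffOp R} (hP : P ≠ 0) : ∃ a, P.OrdLE a ∧ P a ≠ 0 := by
  have hne : P.support.Nonempty := Finsupp.support_nonempty_iff.mpr hP
  refine ⟨P.support.max' hne, fun k hk => ?_, Finsupp.mem_support_iff.mp (P.support.max'_mem hne)⟩
  by_contra h
  exact absurd (P.support.le_max' k (Finsupp.mem_support_iff.mpr h)) (not_le.mpr hk)

/-! ### Additivity of the action of operators on differential polynomials -/

theorem act_zero_left {σ : Type*} (f : DiffPoly σ K) : act (0 : DiffOp K) f = 0 :=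
  Finsupp.sum_zero_index

theorem act_add_left {σ : Type*} (P Q : DiffOp K) (f : DiffPoly σ K) :
    act (P + Q) f = act P f + act Q f :=
  Finsupp.sum_add_index' (fun _ => by rw [map_zero, MulZeroClass.zero_mul])
    fun _ _ _ => by rw [map_add, _root_.add_mul]

theorem act_sum_left {σ ι : Type*} (s : Finset ι) (P : ι → DiffOp K) (f : DiffPoly σ K) :
    act (∑ i ∈ s, P i) f = ∑ i ∈ s, act (P i) f :=
  map_sum (AddMonoidHom.mk' (fun P => act P f) fun P Q => act_add_left P Q f) P s

theorem act_single {σ : Type*} (k : ℕ) (a : K) (f : DiffPoly σ K) :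
    act (Finsupp.single k a) f = MvPolynomial.C a * iterDeriv k f :=
  Finsupp.sum_single_index (by rw [map_zero, MulZeroClass.zero_mul])

end DiffOp

/-! ### Syzygies of matrices of differential operators -/

namespace DiffOp

section Domain

variable {K : Type*} [CommRing K] [IsDomain K] [Differential K]

theorem mul_ne_zero {P Q : DiffOp K} (hP : P ≠ 0) (hQ : Q ≠ 0) : mul P Q ≠ 0 := by
  obtain ⟨a, ha, ha'⟩ := exists_top hP
  obtain ⟨b, hb, hb'⟩ := exists_top hQ
  intro h
  have := ha.mul_apply_add hb
  rw [h, Finsupp.zero_apply] at this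
  exact _root_.mul_ne_zero ha' hb' this.symm

/-- If `P` is left divisible by `P * G`, then `G` is a nonzero constant. -/
theorem eq_single_of_leftDvd {P G : DiffOp K} (hP : P ≠ 0) (h : LeftDvd (mul P G) P) :
    ∃ g : K, g ≠ 0 ∧ G = Finsupp.single 0 g := by
  obtain ⟨H, hH⟩ := h
  have hG : G ≠ 0 := by
    rintro rfl
    rw [mul_zero, zero_mul] at hH
    exact hP hH
  have hH0 : H ≠ 0 := by
    rintro rfl
    rw [mul_zero] at hH
    exact hP hH
  obtain ⟨a, ha, ha'⟩ := exists_top hP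
  obtain ⟨b, hb, hb'⟩ := exists_top hG
  obtain ⟨c, hc, hc'⟩ := exists_top hH0
  have htop := (ha.mul hb).mul_apply_add hc
  rw [← hH, ha.mul_apply_add hb] at htop
  -- The product $PGH = P$ has a nonzero coefficient at the sum of the three orders, so `G` and `H`
  -- have order zero.
  have habc : a + b + c ≤ a := by
    by_contra hlt
    rw [ha _ (not_le.mp hlt)] at htop
    exact _root_.mul_ne_zero (_root_.mul_ne_zero ha' hb') hc' htop.symm
  obtain rfl : b = 0 := by omega
  refine ⟨G 0, hb', Finsupp.ext fun k => ?_⟩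
  rcases Nat.eq_zero_or_pos k with rfl | hk
  · rw [Finsupp.single_eq_same]
  · rw [hb k hk, Finsupp.single_eq_of_ne hk.ne']

end Domain

variable {K : Type*} [Field K] [Differential K]

/-- Division with remainder, the quotient being on the left. -/
theorem exists_quotient {B : DiffOp K} {b : ℕ} (hB : B.OrdLE b) (hb : B b ≠ 0) (A : DiffOp K) :
    ∃ Q : DiffOp K, ∀ k, b ≤ k → (A - mul Q B) k = 0 := by
  have key : ∀ a, ∀ A : DiffOp K, (∀ k, b + a ≤ k → A k = 0) →
      ∃ Q : DiffOp K, ∀ k, b ≤ k → (A - mul Q B) k = 0 := by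
    intro a
    induction a with
    | zero => intro A hA; exact ⟨0, fun k hk => by rw [zero_mul, sub_zero]; exact hA k hk⟩
    | succ a ih =>
      intro A hA
      -- The term `T` is chosen so that $TB$ has the coefficient of `A` at `b + a`; subtracting it
      -- lowers the bound by one.
      set T : DiffOp K := Finsupp.single a (A (b + a) / B b) with hT
      have hTa : T.OrdLE a := fun k hk => Finsupp.single_eq_of_ne hk.ne'
      obtain ⟨Q, hQ⟩ := ih (A - mul T B) fun k hk => by
        rw [Finsupp.sub_apply]
        rcases hk.eq_or_lt with rfl | hk
        · rw [add_comm b a, hTa.mul_apply_add hB, hT, Finsupp.single_eq_same, add_comm a b,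
            div_mul_cancel₀ _ hb, sub_self]
        · rw [hA k (by omega), hTa.mul hB k (by omega), sub_zero]
      refine ⟨T + Q, fun k hk => ?_⟩
      rw [add_mul, ← sub_sub]
      exact hQ k hk
  by_cases hA : A = 0
  · exact ⟨0, fun k _ => by rw [hA, zero_mul, sub_zero, Finsupp.zero_apply]⟩
  · obtain ⟨a, ha, _⟩ := exists_top hA
    exact key (a + 1) A fun k hk => ha k (by omega)

variable {ι κ : Type*} [Fintype ι]

/-- The rows of operators that annihilate the matrix `M` from the left. -/
def IsSyzygy {R : Type*} [CommRing R] [Differential R] (M : ι → κ → DiffOp R)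
    (F : ι → DiffOp R) : Prop :=
  ∀ j, ∑ i, mul (F i) (M i j) = 0

/-- There are no zero divisors in $\mathbb K[\partial]$, so a nonzero left content can be cancelled
from a syzygy. -/
theorem isSyzygy_mul_iff (M : ι → κ → DiffOp K) (F : ι → DiffOp K) {Q : DiffOp K} (hQ : Q ≠ 0) :
    IsSyzygy M (fun i => mul Q (F i)) ↔ IsSyzygy M F := by
  refine forall_congr' fun j => ?_
  simp only [mul_assoc, ← mul_sum]
  refine ⟨fun h => ?_, fun h => by rw [h, mul_zero]⟩
  by_contra hne
  exact mul_ne_zero hQ hne h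

theorem IsSyzygy.sub_mul {M : ι → κ → DiffOp K} {F E : ι → DiffOp K} (hF : IsSyzygy M F)
    (hE : IsSyzygy M E) (Q : DiffOp K) : IsSyzygy M fun i => F i - mul Q (E i) := by
  intro j
  simp only [DiffOp.sub_mul, Finset.sum_sub_distrib, mul_assoc, ← mul_sum, hE j, hF j, mul_zero,
    sub_zero]

/-- A leading coefficient argument: if the weighted leading matrix of `M` has no left kernel vector
vanishing at `i₁`, then `M` has no syzygy vanishing at `i₁`. -/
theorem IsSyzygy.eq_zero_of_leading {M : ι → κ → DiffOp K} (o : ι → ℕ) (γ : κ → ℕ)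
    (hM : ∀ i j k, M i j k ≠ 0 → k + γ j ≤ o i) (i₁ : ι)
    (hker : ∀ g : ι → K,
      (∀ j, ∑ i, g i * (if γ j ≤ o i then M i j (o i - γ j) else 0) = 0) → g i₁ = 0 → g = 0)
    {F : ι → DiffOp K} (hF : IsSyzygy M F) (h₁ : F i₁ = 0) : F = 0 := by
  classical
  by_contra hne
  -- The weight of the term $\partial^k$ in component $i$ is $k + o_i$. The coefficients of maximal
  -- weight $d$ will form a left kernel vector of the leading matrix.
  set s : Finset ℕ := Finset.univ.biUnion fun i => (F i).support.image fun k => k + o i with hs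
  have hmem : ∀ d, d ∈ s ↔ ∃ i k, F i k ≠ 0 ∧ k + o i = d := by
    intro d
    simp only [hs, Finset.mem_biUnion, Finset.mem_univ, true_and, Finset.mem_image,
      Finsupp.mem_support_iff]
  have hsne : s.Nonempty := by
    obtain ⟨i, hi⟩ := Function.ne_iff.mp hne
    obtain ⟨k, hk⟩ := Finsupp.ne_iff.mp hi
    exact ⟨k + o i, (hmem _).mpr ⟨i, k, hk, rfl⟩⟩
  set d := s.max' hsne with hd
  have hFd : ∀ i k, F i k ≠ 0 → k + o i ≤ d := fun i k hk =>
    s.le_max' _ ((hmem _).mpr ⟨i, k, hk, rfl⟩)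
  obtain ⟨i₀, k₀, hk₀, hd₀⟩ := (hmem d).mp (s.max'_mem hsne)
  have hg := hker (fun i => if o i ≤ d then F i (d - o i) else 0) ?_ (by simp [h₁])
  · have := congrFun hg i₀
    simp only [Pi.zero_apply] at this
    rw [if_pos (by omega), show d - o i₀ = k₀ by omega] at this
    exact hk₀ this
  · intro j
    by_cases hj : γ j ≤ d
    · have hsum := DFunLike.congr_fun (hF j) (d - γ j)
      rw [Finsupp.finsetSum_apply, Finsupp.zero_apply] at hsum
      refine (Finset.sum_congr rfl fun i _ => ?_).trans hsum
      by_cases hi : o i ≤ d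
      · have hFi : (F i).OrdLE (d - o i) := fun k hk => by
          by_contra h
          have := hFd i k h
          omega
        by_cases hij : γ j ≤ o i
        · have hMi : (M i j).OrdLE (o i - γ j) := fun k hk => by
            by_contra h
            have := hM i j k h
            omega
          rw [if_pos hi, if_pos hij, ← hFi.mul_apply_add hMi]
          congr 1
          omega
        · have hMi : M i j = 0 := Finsupp.ext fun k => by
            by_contra h
            have := hM i j k h
            omega
          rw [if_neg hij, hMi, DiffOp.mul_zero, MulZeroClass.mul_zero, Finsupp.zero_apply]
      · have hFi : F i = 0 := Finsupp.ext fun k => by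
          by_contra h
          have := hFd i k h
          omega
        rw [if_neg hi, hFi, DiffOp.zero_mul, MulZeroClass.zero_mul, Finsupp.zero_apply]
    -- Here $\gamma_j > d$, so $o_i \le d$ gives $o_i < \gamma_j$ and the weighted entry is zero by
    -- convention.
    · refine Finset.sum_eq_zero fun i _ => ?_
      by_cases hi : o i ≤ d
      · rw [if_neg (by omega : ¬ γ j ≤ o i), MulZeroClass.mul_zero]
      · rw [if_neg hi, MulZeroClass.zero_mul]

/-- If projection to the component `i₁` is injective on syzygies, they are all left multiples of a
single one. -/
theorem exists_generator {M : ι → κ → DiffOp K} {i₁ : ι}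
    (hinj : ∀ F : ι → DiffOp K, IsSyzygy M F → F i₁ = 0 → F = 0) {F₀ : ι → DiffOp K}
    (hF₀ : IsSyzygy M F₀) (hF₀' : F₀ ≠ 0) :
    ∃ E : ι → DiffOp K, IsSyzygy M E ∧ ∀ F, IsSyzygy M F → ∃ Q, ∀ i, F i = mul Q (E i) := by
  classical
  -- Take a syzygy whose component `i₁` has least order. Division leaves a syzygy of smaller order
  -- there, which must vanish at `i₁` and hence everywhere.
  have hex : ∃ d, ∃ E : ι → DiffOp K, IsSyzygy M E ∧ (E i₁).OrdLE d ∧ E i₁ d ≠ 0 := by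
    obtain ⟨d, hd⟩ := exists_top fun h => hF₀' (hinj F₀ hF₀ h)
    exact ⟨d, F₀, hF₀, hd⟩
  obtain ⟨E, hE, hle, hne⟩ := Nat.find_spec hex
  refine ⟨E, hE, fun F hF => ?_⟩
  obtain ⟨Q, hQ⟩ := exists_quotient hle hne (F i₁)
  refine ⟨Q, fun i => ?_⟩
  have hR := hF.sub_mul hE Q
  have hR₁ : F i₁ - mul Q (E i₁) = 0 := by
    by_contra h
    obtain ⟨d, hd, hd'⟩ := exists_top h
    have hlt : d < Nat.find hex := not_le.mp fun hle => hd' (hQ d hle)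
    exact Nat.find_min hex hlt ⟨_, hR, hd, hd'⟩
  exact sub_eq_zero.mp (congrFun (hinj _ hR hR₁) i)

/-- If the syzygies of `M` are generated by one of them and `G` is a syzygy without left content,
every syzygy has at least the order of `G` in each component of `G`. -/
theorem IsSyzygy.eq_zero_of_lt {M : ι → κ → DiffOp K} {i₁ : ι}
    (hinj : ∀ F : ι → DiffOp K, IsSyzygy M F → F i₁ = 0 → F = 0) {B G : ι → DiffOp K}
    {P : DiffOp K} (hP : IsGCLD P B) (hPG : ∀ i, B i = mul P (G i)) (hP0 : P ≠ 0)
    (hG : IsSyzygy M G) {i₀ : ι} {d : ℕ} (hd : G i₀ d ≠ 0) {F : ι → DiffOp K}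
    (hF : IsSyzygy M F) (hlt : ∀ k, d ≤ k → F i₀ k = 0) : F = 0 := by
  have hG0 : G ≠ 0 := by
    rintro rfl
    exact hd rfl
  obtain ⟨E, -, hgen⟩ := exists_generator hinj hG hG0
  obtain ⟨Q, hQ⟩ := hgen G hG
  -- From $B = PG = PQE$, the operator $PQ$ is a common left divisor of `B`, so it left-divides the
  -- greatest one `P`; thus `Q` is a constant.
  obtain ⟨g, hg, rfl⟩ : ∃ g : K, g ≠ 0 ∧ Q = Finsupp.single 0 g :=
    eq_single_of_leftDvd hP0 (hP.2 _ fun i => ⟨E i, by rw [hPG, hQ, mul_assoc]⟩)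
  have hE : E i₀ d ≠ 0 := by
    intro h
    rw [hQ, mul_single] at hd
    exact hd (by rw [Finsupp.smul_apply, Function.iterate_zero_apply, h, smul_zero])
  obtain ⟨T, hT⟩ := hgen F hF
  obtain ⟨e, he, he'⟩ := exists_top (P := E i₀) (by intro h; rw [h] at hE; exact hE rfl)
  have hde : d ≤ e := not_lt.mp fun h => hE (he d h)
  by_cases hT0 : T = 0
  · funext i
    rw [hT, hT0, zero_mul, Pi.zero_apply]
  · exfalso
    -- A nonzero multiple $TE$ has order $t + e \ge d$ in component `i₀`, against the assumption on
    -- `F`.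
    obtain ⟨t, ht, ht'⟩ := exists_top hT0
    have := ht.mul_apply_add he
    rw [← hT, hlt _ (by omega)] at this
    exact _root_.mul_ne_zero ht' he' this.symm

/-- A matrix with `n` rows and rank `n - 1` has a row such that a left kernel vector is zero as
soon as its entry at this row is zero. -/
theorem exists_row_of_rank {R : Type*} [Field R] {n m : ℕ} (hn : 0 < n)
    (S : Matrix (Fin n) (Fin m) R)
    (hS : S.rank = n - 1) :
    ∃ i₁, ∀ g : Fin n → R, (∀ j, ∑ i, g i * S i j = 0) → g i₁ = 0 → g = 0 := by
  have hker : Module.finrank R (LinearMap.ker S.transpose.mulVecLin) = 1 := by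
    have := S.transpose.mulVecLin.finrank_range_add_finrank_ker
    rw [Module.finrank_fin_fun] at this
    have hr : Module.finrank R (LinearMap.range S.transpose.mulVecLin) = n - 1 := by
      rw [← hS, ← S.rank_transpose]; rfl
    omega
  obtain ⟨⟨w, hw⟩, hw0, hspan⟩ := finrank_eq_one_iff'.mp hker
  -- The left kernel is the line spanned by `w`; any index at which `w` is nonzero will do.
  obtain ⟨i₁, hi₁⟩ := Function.ne_iff.mp fun h : w = 0 => hw0 (Subtype.ext h)
  refine ⟨i₁, fun g hg hg₁ => ?_⟩
  have hgk : g ∈ LinearMap.ker S.transpose.mulVecLin := by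
    rw [LinearMap.mem_ker]
    funext j
    rw [Matrix.mulVecLin_apply, Pi.zero_apply, ← hg j, Matrix.mulVec, dotProduct]
    exact Finset.sum_congr rfl fun i _ => mul_comm _ _
  obtain ⟨c, hc⟩ := hspan ⟨g, hgk⟩
  have hc' : c • w = g := congrArg Subtype.val hc
  have : c * w i₁ = 0 := by rw [← hg₁, ← hc']; rfl
  rw [← hc', (mul_eq_zero.mp this).resolve_right hi₁, zero_smul]

end DiffOp

/-! ### Ideals with a single linear characteristic polynomial -/

namespace IsRanking

variable {σ : Type*} {r : σ × ℕ → σ × ℕ → Prop}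

theorem lt_of_lt (hr : IsRanking r) (i : σ) {k l : ℕ} (h : k < l) : r (i, k) (i, l) := by
  induction l, h using Nat.le_induction with
  | base => exact hr.lt_deriv i k
  | succ l _ ih => exact hr.trans _ _ _ ih (hr.lt_deriv i l)

theorem asymm (hr : IsRanking r) {u v : σ × ℕ} (h : r u v) : ¬ r v u := fun h' =>
  hr.irrefl u (hr.trans _ _ _ h h')

theorem exists_max (hr : IsRanking r) {s : Finset (σ × ℕ)} (hs : s.Nonempty) :
    ∃ v ∈ s, ∀ w ∈ s, w = v ∨ r w v := by
  induction hs using Finset.Nonempty.cons_induction with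
  | singleton a => exact ⟨a, Finset.mem_singleton_self a, fun w hw => .inl (by simpa using hw)⟩
  | cons a s ha _ ih =>
    obtain ⟨v, hv, hmax⟩ := ih
    rcases hr.trichotomous a v with h | h | h
    · refine ⟨v, Finset.mem_cons_of_mem hv, fun w hw => ?_⟩
      rcases Finset.mem_cons.mp hw with rfl | hw
      exacts [.inr h, hmax w hw]
    · exact absurd (h ▸ hv) ha
    · refine ⟨a, Finset.mem_cons_self a s, fun w hw => ?_⟩
      rcases Finset.mem_cons.mp hw with rfl | hw
      · exact .inl rfl
      · rcases hmax w hw with rfl | hwv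
        exacts [.inr h, .inr (hr.trans _ _ _ hwv h)]

end IsRanking

namespace CharSet

open MvPolynomial

variable {σ K : Type*} [Field K] {r : σ × ℕ → σ × ℕ → Prop} {f A : DiffPoly σ K}

theorem exists_isLeader (hr : IsRanking r)
    (hf : f ∉ Set.range (C : K → DiffPoly σ K)) : ∃ v, IsLeader r f v := by
  have hne : f.vars.Nonempty := by
    rw [Finset.nonempty_iff_ne_empty, Ne, vars_eq_empty_iff_eq_C]
    exact fun h => hf ⟨_, h.symm⟩
  obtain ⟨v, hv, hmax⟩ := hr.exists_max hne
  exact ⟨v, hv, hmax⟩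

theorem IsLeader.le (hr : IsRanking r) {v : σ × ℕ} (hv : IsLeader r f v) {k : ℕ}
    (hk : (v.1, k) ∈ f.vars) : k ≤ v.2 := by
  by_contra h
  have hlt := hr.lt_of_lt v.1 (not_le.mp h)
  rcases hv.2 _ hk with h' | h'
  · exact h (congrArg Prod.snd h').le
  · exact hr.asymm h' hlt

/-- The ideal `I` contains no nonzero polynomial that is free of the derivatives of a highest
derivative present in `A`. -/
def IsMinimalIn (I : Ideal (DiffPoly σ K)) (A : DiffPoly σ K) : Prop :=
  ∀ v ∈ A.vars, (∀ k, (v.1, k) ∈ A.vars → k ≤ v.2) →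
    ∀ f ∈ I, (∀ k, v.2 ≤ k → (v.1, k) ∉ f.vars) → f = 0

variable {I : Ideal (DiffPoly σ K)}

/-- Since `A` has degree one in its leader, being reduced means being free of the leader as well as
of its proper derivatives. -/
theorem IsMinimalIn.eq_zero_of_isReduced (hr : IsRanking r) (hmin : IsMinimalIn I A)
    (hdeg : A.totalDegree ≤ 1) {v : σ × ℕ} (hv : IsLeader r A v) (hf : f ∈ I)
    (hred : (∀ k, v.2 < k → (v.1, k) ∉ f.vars) ∧ degreeOf v f < degreeOf v A) : f = 0 := by
  refine hmin v hv.1 (fun k => hv.le hr) f hf fun k hk => ?_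
  rcases hk.eq_or_lt with rfl | hk
  · rw [mem_vars_iff_degreeOf_ne_zero, not_not]
    have h1 := hred.2
    have h2 := degreeOf_le_totalDegree A v
    change degreeOf v f = 0
    omega
  · exact hred.1 k hk

theorem degreeOf_leader (hdeg : A.totalDegree ≤ 1) {v : σ × ℕ} (hv : IsLeader r A v) :
    degreeOf v A = 1 := by
  have h1 := mem_vars_iff_degreeOf_ne_zero.mp hv.1
  have h2 := degreeOf_le_totalDegree A v
  omega

/-- A polynomial with leader below that of `A` contains neither the leader of `A` nor a derivative
of it, as these rank higher. With equal leaders its degree there would have to be zero. -/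
theorem IsMinimalIn.not_rankLT (hr : IsRanking r) (hmin : IsMinimalIn I A)
    (hdeg : A.totalDegree ≤ 1) (hf : f ∈ I) : ¬ RankLT r f A := by
  rintro ⟨u, v, hu, hv, h⟩
  have hu0 := mem_vars_iff_degreeOf_ne_zero.mp hu.1
  rcases h with h | ⟨rfl, h⟩
  · have hnot : ∀ k, v.2 ≤ k → (v.1, k) ∉ f.vars := by
      intro k hk hmem
      have hvk : v = (v.1, k) ∨ r v (v.1, k) := by
        rcases hk.eq_or_lt with rfl | hk
        exacts [.inl rfl, .inr (hr.lt_of_lt v.1 hk)]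
      have huk : r u (v.1, k) := by
        rcases hvk with h' | h'
        exacts [h' ▸ h, hr.trans _ _ _ h h']
      rcases hu.2 _ hmem with h' | h'
      · rw [h'] at huk
        exact hr.irrefl _ huk
      · exact hr.asymm h' huk
    have hf0 := hmin v hv.1 (fun k => hv.le hr) f hf hnot
    rw [hf0] at hu0
    exact hu0 (degreeOf_zero u)
  · rw [degreeOf_leader hdeg hv] at h
    omega

/-- The elements of an autoreduced subset of `I` following one of the rank of `A` vanish. -/
theorem IsMinimalIn.eq_zero_of_same_rank (hr : IsRanking r) (hmin : IsMinimalIn I A)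
    (hdeg : A.totalDegree ≤ 1) (hA : A ∉ Set.range (C : K → DiffPoly σ K))
    (hf : f ∉ Set.range (C : K → DiffPoly σ K)) (h1 : ¬ RankLT r f A) (h2 : ¬ RankLT r A f)
    {g : DiffPoly σ K} (hg : g ∈ I) (hgf : IsReduced r g f) : g = 0 := by
  obtain ⟨u, hu⟩ := exists_isLeader hr hf
  obtain ⟨v, hv⟩ := exists_isLeader hr hA
  obtain rfl : u = v := by
    rcases hr.trichotomous u v with h | h | h
    exacts [absurd ⟨u, v, hu, hv, .inl h⟩ h1, h, absurd ⟨v, u, hv, hu, .inl h⟩ h2]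
  have hle : degreeOf u f ≤ degreeOf u A :=
    not_lt.mp fun h => h2 ⟨u, u, hv, hu, .inr ⟨rfl, h⟩⟩
  obtain ⟨hred, hlt⟩ := hgf u hu
  exact hmin.eq_zero_of_isReduced hr hdeg hv hg ⟨hred, hlt.trans_le hle⟩

/-- A chain below `[A]` starts either with a polynomial of lower rank than `A`, or with one of the
same rank followed by a second element. That second element is reduced with respect to the first, so
it is zero, which autoreduced sets exclude. -/
theorem IsMinimalIn.isCharSet (hr : IsRanking r) (hmin : IsMinimalIn I A)
    (hdeg : A.totalDegree ≤ 1) (hA : A ∉ Set.range (C : K → DiffPoly σ K)) (hAI : A ∈ I) :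
    IsCharSet r I [A] := by
  refine ⟨⟨⟨by simpa using hA, List.pairwise_singleton _ _⟩, by simpa using hAI⟩, ?_⟩
  rintro (_ | ⟨f, B⟩) hl hlI hlt
  · exact hlt
  · have hfI : f ∈ I := hlI f List.mem_cons_self
    rcases hlt with h | ⟨h1, h2, h3⟩
    · exact hmin.not_rankLT hr hdeg hfI h
    · rcases B with _ | ⟨g, B⟩
      · exact h3
      · have hg : g ∈ f :: g :: B := by simp
        have hred := ((List.pairwise_cons.mp hl.2).1 g List.mem_cons_self).2.2
        have hg0 := hmin.eq_zero_of_same_rank hr hdeg hA (hl.1 f List.mem_cons_self) h1 h2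
          (hlI g hg) hred
        exact hl.1 g hg ⟨0, by rw [hg0, map_zero]⟩

/-- Comparison with `[A]` excludes the empty chain and forces the first element to have the rank of
`A`, after which nothing nonzero can follow. -/
theorem IsMinimalIn.length_eq_one (hr : IsRanking r) (hmin : IsMinimalIn I A)
    (hdeg : A.totalDegree ≤ 1) (hA : A ∉ Set.range (C : K → DiffPoly σ K)) (hAI : A ∈ I)
    {l : List (DiffPoly σ K)} (hl : IsCharSet r I l) : l.length = 1 := by
  obtain ⟨⟨hA1, hA2⟩, -⟩ := hmin.isCharSet hr hdeg hA hAI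
  rcases l with _ | ⟨f, _ | ⟨g, B⟩⟩
  · exact (hl.2 [A] hA1 hA2 trivial).elim
  · rfl
  · have hg : g ∈ f :: g :: B := by simp
    have h1 := hmin.not_rankLT hr hdeg (hl.1.2 f List.mem_cons_self)
    have h2 : ¬ RankLT r A f := fun h => hl.2 [A] hA1 hA2 (.inl h)
    have hred := ((List.pairwise_cons.mp hl.1.1.2).1 g List.mem_cons_self).2.2
    have hg0 := hmin.eq_zero_of_same_rank hr hdeg hA (hl.1.1.1 f List.mem_cons_self) h1 h2
      (hl.1.2 g hg) hred
    exact (hl.1.1.1 g hg ⟨0, by rw [hg0, map_zero]⟩).elim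

theorem irreducible_of_totalDegree_le_one (hdeg : A.totalDegree ≤ 1)
    (hA : A ∉ Set.range (C : K → DiffPoly σ K)) : Irreducible A := by
  refine irreducible_of_totalDegree_eq_one (hdeg.antisymm ?_) fun x hx => ?_
  · rw [Nat.one_le_iff_ne_zero, Ne, totalDegree_eq_zero_iff_eq_C]
    exact fun h => hA ⟨_, h.symm⟩
  · refine isUnit_iff_ne_zero.mpr ?_
    rintro rfl
    exact hA ⟨0, by rw [map_zero]; ext s; exact (zero_dvd_iff.mp (hx s)).symm⟩

theorem IsMinimalIn.hasDimension_and_isCharPoly {n : ℕ} (hn : 1 ≤ n)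
    {I : Ideal (DiffPoly (Fin n) K)} {A : DiffPoly (Fin n) K} (hmin : IsMinimalIn I A)
    (hdeg : A.totalDegree ≤ 1) (hA : A ∉ Set.range (C : K → DiffPoly (Fin n) K)) (hAI : A ∈ I) :
    HasDimension I (n - 1) ∧ IsCharPoly I A := by
  refine ⟨fun r hr => ⟨⟨[A], hmin.isCharSet hr hdeg hA hAI⟩, fun l hl => ?_⟩,
    irreducible_of_totalDegree_le_one hdeg hA, fun r hr => hmin.isCharSet hr hdeg hA hAI⟩
  rw [hmin.length_eq_one hr hdeg hA hAI hl]
  push_cast [hn]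
  rfl

end CharSet

/-! ### The linear part of the implicit ideal -/

namespace DiffOp

open MvPolynomial

variable {σ K : Type*} [CommRing K] [Differential K]

theorem act_smul_left (a : K) (Q : DiffOp K) (f : DiffPoly σ K) :
    act (a • Q) f = C a * act Q f := by
  induction Q using Finsupp.induction_linear with
  | zero => rw [smul_zero, act_zero_left, MulZeroClass.mul_zero]
  | add x y hx hy => rw [smul_add, act_add_left, act_add_left, hx, hy, _root_.mul_add]
  | single k b =>
    rw [Finsupp.smul_single, act_single, act_single, smul_eq_mul, C_mul, _root_.mul_assoc]

theorem act_derivMul (Q : DiffOp K) (f : DiffPoly σ K) : act (derivMul Q) f = (act Q f)′ := by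
  induction Q using Finsupp.induction_linear with
  | zero => rw [derivMul_zero, act_zero_left, map_zero]
  | add x y hx hy => rw [derivMul_add, act_add_left, act_add_left, hx, hy, map_add]
  | single k b =>
    rw [derivMul_single, act_add_left, act_single, act_single, act_single, DiffPoly.deriv_C_mul,
      iterDeriv_succ]

theorem act_derivMul_iterate (k : ℕ) (Q : DiffOp K) (f : DiffPoly σ K) :
    act (derivMul^[k] Q) f = iterDeriv k (act Q f) := by
  induction k with
  | zero => rfl
  | succ k ih => rw [Function.iterate_succ_apply', act_derivMul, ih, iterDeriv_succ]

theorem act_mul (P Q : DiffOp K) (f : DiffPoly σ K) : act (mul P Q) f = act P (act Q f) := by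
  induction P using Finsupp.induction_linear with
  | zero => rw [zero_mul, act_zero_left, act_zero_left]
  | add x y hx hy => rw [add_mul, act_add_left, act_add_left, hx, hy]
  | single k a => rw [mul_single, act_smul_left, act_derivMul_iterate, act_single]

theorem act_add (P : DiffOp K) (f g : DiffPoly σ K) : act P (f + g) = act P f + act P g := by
  simp only [act, iterDeriv_add, _root_.mul_add, Finsupp.sum_add]

theorem act_sub (P : DiffOp K) (f g : DiffPoly σ K) : act P (f - g) = act P f - act P g :=
  map_sub (AddMonoidHom.mk' (act P) (act_add P)) f g

theorem act_sum {ι : Type*} (s : Finset ι) (P : DiffOp K) (f : ι → DiffPoly σ K) :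
    act P (∑ i ∈ s, f i) = ∑ i ∈ s, act P (f i) :=
  map_sum (AddMonoidHom.mk' (act P) (act_add P)) f s

theorem exists_act_C (P : DiffOp K) (a : K) :
    ∃ b, act P (C a : DiffPoly σ K) = C b := by
  refine ⟨P.sum fun k c => c * iterDeriv k a, ?_⟩
  rw [act, Finsupp.sum, Finsupp.sum, map_sum]
  refine Finset.sum_congr rfl fun k _ => ?_
  rw [C_mul, iterDeriv_map C fun a => (DiffPoly.deriv_C a).symm]

theorem map_act {τ : Type*} (θ : DiffPoly σ K →ₐ[K] DiffPoly τ K)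
    (hθ : ∀ f, θ (f′) = (θ f)′) (P : DiffOp K) (f : DiffPoly σ K) :
    θ (act P f) = act P (θ f) := by
  rw [act, act, Finsupp.sum, Finsupp.sum, map_sum]
  refine Finset.sum_congr rfl fun k _ => ?_
  rw [map_mul, algHom_C]
  exact congrArg _ (iterDeriv_map θ.toRingHom hθ k f)

theorem act_X (P : DiffOp K) (j : σ) :
    act P (X (j, 0) : DiffPoly σ K) = P.sum fun k a => C a * X (j, k) := by
  simp only [act, DiffPoly.iterDeriv_X]

theorem act_X_mem_affineForms (P : DiffOp K) (j : σ) :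
    act P (X (j, 0) : DiffPoly σ K) ∈ DiffPoly.affineForms K Set.univ := by
  rw [act_X]
  refine Submodule.sum_mem _ fun k _ => ?_
  dsimp only
  rw [← smul_eq_C_mul]
  exact Submodule.smul_mem _ _ (DiffPoly.X_mem_affineForms (Set.mem_univ _))

theorem coeff_sum_act_X [Fintype σ] (G : σ → DiffOp K) (i : σ) (k : ℕ) :
    coeff (Finsupp.single (i, k) 1) (∑ j, act (G j) (X (j, 0) : DiffPoly σ K)) = G i k := by
  classical
  rw [coeff_sum, Finset.sum_eq_single i]
  · rw [act_X, Finsupp.sum, coeff_sum, Finset.sum_eq_single k]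
    · rw [coeff_C_mul, coeff_X, if_pos rfl, mul_one]
    · intro l _ hl
      rw [coeff_C_mul, coeff_X, if_neg, MulZeroClass.mul_zero]
      rw [Finsupp.single_left_inj one_ne_zero]
      exact fun h => hl (congrArg Prod.snd h)
    · intro h
      rw [Finsupp.notMem_support_iff.mp h, map_zero, MulZeroClass.zero_mul, coeff_zero]
  · intro j _ hj
    rw [act_X, Finsupp.sum, coeff_sum]
    refine Finset.sum_eq_zero fun l _ => ?_
    rw [coeff_C_mul, coeff_X, if_neg, MulZeroClass.mul_zero]
    rw [Finsupp.single_left_inj one_ne_zero]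
    exact fun h => hj (congrArg Prod.fst h)
  · exact fun h => absurd (Finset.mem_univ i) h

/-- The operator formed by the coefficients of the derivatives of `y_j` in `f`. -/
noncomputable def ofDiffPoly {R : Type*} [CommRing R] (f : DiffPoly σ R) (j : σ) : DiffOp R :=
  Finsupp.onFinset (f.vars.image Prod.snd) (fun k => coeff (Finsupp.single (j, k) 1) f) fun k hk =>
    Finset.mem_image_of_mem Prod.snd (a := (j, k)) <|
      (mem_vars_iff_mem_support _).mpr ⟨_, mem_support_iff.mpr hk, by simp⟩

theorem eq_C_add_sum_act [Fintype σ] {f : DiffPoly σ K} (hf : f.totalDegree ≤ 1) :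
    f = C (constantCoeff f) + ∑ j, act (ofDiffPoly f j) (X (j, 0)) := by
  classical
  set s : Finset ℕ := f.vars.image Prod.snd with hs
  have hsub : (f.vars : Set (σ × ℕ)) ⊆ ((Finset.univ ×ˢ s : Finset (σ × ℕ)) : Set (σ × ℕ)) := by
    intro v hv
    rw [Finset.coe_product]
    exact ⟨Finset.mem_coe.mpr (Finset.mem_univ _), Finset.mem_image_of_mem _ hv⟩
  have h := DiffPoly.eq_sum_of_mem_affineForms
    (DiffPoly.affineForms_mono hsub (DiffPoly.mem_affineForms_of_totalDegree_le hf))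
  conv_lhs => rw [h, Finset.sum_product]
  congr 1
  refine Finset.sum_congr rfl fun j _ => ?_
  rw [act_X, Finsupp.sum_of_support_subset (s := s)]
  · rfl
  · exact Finsupp.support_onFinset_subset
  · intro k _
    rw [map_zero, MulZeroClass.zero_mul]

end DiffOp

namespace DiffRes

open DiffPoly

theorem add_gammaAt_le {n r : ℕ} {R : Type*} [CommRing R] (f : Fin n → DiffPoly (Fin r) R)
    {i : Fin n} {v : Fin r × ℕ} (hv : v ∈ (f i).vars) : v.2 + gammaAt f v.1 ≤ order (f i) := by
  have hγ : gammaAt f v.1 ≤ ((order (f i) : ℤ) - ord (f i) v.1).toNat :=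
    ciInf_le (OrderBot.bddBelow _) i
  -- This covers the case in which `toNat` truncates and the bound on `gammaAt` reads zero.
  have ho : v.2 ≤ order (f i) := Finset.le_sup (f := fun v : Fin r × ℕ => v.2) hv
  have hj : v.2 + 1 ≤ ((f i).vars.filter (fun w => w.1 = v.1)).sup (fun w => w.2 + 1) :=
    Finset.le_sup (f := fun w : Fin r × ℕ => w.2 + 1) (Finset.mem_filter.mpr ⟨hv, rfl⟩)
  rw [ord] at hγ
  omega

end DiffRes

/-! ### The operator matrix of the system and the syzygies describing its implicit ideal -/

namespace LinearDPPE

open MvPolynomial DiffPoly DiffRes DiffOp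

variable {n : ℕ} {K : Type*}

/-- The operators giving the homogeneous parts of the `P_i`. -/
noncomputable def operators [CommRing K] (S : LinearDPPE n K) (i : Fin n) (j : Fin (n - 1)) :
    DiffOp K :=
  ofDiffPoly (S.P i) j

theorem add_gammaAt_le_order [CommRing K] (S : LinearDPPE n K) (i : Fin n) (j : Fin (n - 1))
    (k : ℕ) (h : S.operators i j k ≠ 0) : k + gammaAt S.F j ≤ order (S.F i) := by
  refine add_gammaAt_le S.F (v := (j, k)) ((mem_vars_iff_mem_support _).mpr
    ⟨Finsupp.single (j, k) 1, mem_support_iff.mpr ?_, by simp⟩)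
  rw [F, coeff_sub, coeff_single_C, zero_sub, coeff_map, Ne, neg_eq_zero, C_eq_zero]
  exact h

/-- The sign comes from $F_i = x_i - P_i$. Neither it nor the reversal of the columns changes the
left kernel, so the rank condition transfers to the weighted top coefficients of `operators`. -/
theorem leadingMatrix_apply [CommRing K] (S : LinearDPPE n K) (i : Fin n) (j : Fin (n - 1)) :
    S.leadingMatrix i j = -(if gammaAt S.F j.rev ≤ order (S.F i) then
      S.operators i j.rev (order (S.F i) - gammaAt S.F j.rev) else 0) := by
  rw [leadingMatrix, Matrix.of_apply]
  split_ifs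
  · rw [varCoeff, H, coeff_sub, coeff_single_C, zero_sub]
    rfl
  · rw [neg_zero]

theorem exists_row [Field K] [Differential K] (S : LinearDPPE n K) (hn : 0 < n)
    (hS : S.leadingMatrix.rank = n - 1) :
    ∃ i₁, ∀ F : Fin n → DiffOp K, IsSyzygy S.operators F → F i₁ = 0 → F = 0 := by
  obtain ⟨i₁, hi₁⟩ := exists_row_of_rank hn _ hS
  refine ⟨i₁, fun F hF h₁ => hF.eq_zero_of_leading (fun i => order (S.F i)) (gammaAt S.F)
    S.add_gammaAt_le_order i₁ (fun g hg => hi₁ g fun j => ?_) h₁⟩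
  simp only [leadingMatrix_apply, mul_neg, Finset.sum_neg_distrib, hg j.rev, neg_zero]

theorem P_pos [CommRing K] (S : LinearDPPE n K) : 0 < n := by
  obtain ⟨i, -⟩ := S.exists_nonconstant
  exact i.pos

/-- The substitution `x_i ↦ P_i(U)`. -/
noncomputable def subst [CommRing K] [Differential K] (S : LinearDPPE n K) :
    DiffPoly (Fin n) K →ₐ[K] DiffPoly (Fin (n - 1)) K :=
  aeval fun v : Fin n × ℕ => iterDeriv v.2 (S.P v.1)

section CommRing

variable [CommRing K] [Differential K] (S : LinearDPPE n K)

theorem mem_implicitIdeal {f : DiffPoly (Fin n) K} : f ∈ S.implicitIdeal ↔ S.subst f = 0 :=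
  Iff.rfl

theorem subst_deriv (f : DiffPoly (Fin n) K) : S.subst (f′) = (S.subst f)′ := by
  refine map_deriv_of_C_of_X S.subst.toRingHom (fun a => ?_) (fun v => ?_) f
  · change S.subst (C _) = Differential.deriv (S.subst (C a))
    rw [algHom_C, algHom_C]
    exact (deriv_C a).symm
  · change S.subst (X _) = Differential.deriv (S.subst (X v))
    rw [subst, aeval_X, aeval_X, iterDeriv_succ]

theorem P_sub_C (i : Fin n) :
    S.P i - C (S.a i) = ∑ j, act (S.operators i j) (X (j, 0)) := by
  rw [sub_eq_iff_eq_add', a]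
  exact eq_C_add_sum_act (S.totalDegree_le i)

theorem sum_act_P_sub_C (F : Fin n → DiffOp K) :
    ∑ i, act (F i) (S.P i - C (S.a i)) =
      ∑ j, act (∑ i, DiffOp.mul (F i) (S.operators i j)) (X (j, 0)) := by
  simp only [P_sub_C, act_sum, act_sum_left, act_mul]
  exact Finset.sum_comm

/-- The linear differential polynomial `∑ 𝓕_i (x_i - a_i)`. -/
noncomputable def linearPoly (F : Fin n → DiffOp K) : DiffPoly (Fin n) K :=
  ∑ i, (F i).act (X (i, 0) - C (S.a i))

theorem linearPoly_zero : S.linearPoly 0 = 0 := by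
  simp only [linearPoly, Pi.zero_apply, act_zero_left, Finset.sum_const_zero]

/-- The shift by $a_i$ makes the substituted polynomial homogeneous: it becomes $\sum_j \bigl(\sum_i
\mathcal F_i M_{ij}\bigr)(u_j)$, whose coefficients are exactly the entries of the syzygy relation.
-/
theorem linearPoly_mem_implicitIdeal (F : Fin n → DiffOp K) :
    S.linearPoly F ∈ S.implicitIdeal ↔ IsSyzygy S.operators F := by
  have h : S.subst (S.linearPoly F) =
      ∑ j, act (∑ i, DiffOp.mul (F i) (S.operators i j)) (X (j, 0)) := by
    rw [← sum_act_P_sub_C, linearPoly, map_sum]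
    refine Finset.sum_congr rfl fun i _ => ?_
    rw [map_act _ S.subst_deriv, map_sub, algHom_C, subst, aeval_X]
    rfl
  rw [mem_implicitIdeal, h]
  constructor
  · intro h0 j
    ext k
    rw [← coeff_sum_act_X (fun j => ∑ i, DiffOp.mul (F i) (S.operators i j)) j k, h0, coeff_zero,
      Finsupp.zero_apply]
  · intro h0
    simp only [h0 _, act_zero_left, Finset.sum_const_zero]

theorem isSyzygy_of_coeff_eq_zero (F : Fin n → DiffOp K)
    (h : ∀ v, coeff (Finsupp.single v 1) (∑ i, act (F i) (S.P i)) = 0) :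
    IsSyzygy S.operators F := by
  intro j
  ext k
  rw [← coeff_sum_act_X (fun j => ∑ i, DiffOp.mul (F i) (S.operators i j)) j k,
    ← sum_act_P_sub_C, Finsupp.zero_apply, ← h (j, k), coeff_sum, coeff_sum]
  refine Finset.sum_congr rfl fun i _ => ?_
  obtain ⟨b, hb⟩ := exists_act_C (σ := Fin (n - 1)) (F i) (S.a i)
  rw [act_sub, hb, coeff_sub, coeff_single_C, sub_zero]

theorem exists_linearPoly_eq (F : Fin n → DiffOp K) :
    ∃ b, S.linearPoly F = C b + ∑ i, act (F i) (X (i, 0)) := by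
  choose b hb using fun i => exists_act_C (σ := Fin n) (F i) (S.a i)
  refine ⟨-∑ i, b i, ?_⟩
  simp only [linearPoly, act_sub, hb, Finset.sum_sub_distrib, map_neg, map_sum]
  ring

theorem totalDegree_linearPoly_le (F : Fin n → DiffOp K) : (S.linearPoly F).totalDegree ≤ 1 := by
  obtain ⟨b, hb⟩ := S.exists_linearPoly_eq F
  rw [hb]
  exact totalDegree_le_of_mem_affineForms (W := Set.univ) (Submodule.add_mem _
    (C_mem_affineForms _ b) (Submodule.sum_mem _ fun i _ => act_X_mem_affineForms (F i) i))

theorem coeff_linearPoly (F : Fin n → DiffOp K) (v : Fin n × ℕ) :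
    coeff (Finsupp.single v 1) (S.linearPoly F) = F v.1 v.2 := by
  obtain ⟨b, hb⟩ := S.exists_linearPoly_eq F
  rw [hb, coeff_add, coeff_single_C, zero_add]
  exact coeff_sum_act_X F v.1 v.2

end CommRing

variable [Field K] [Differential K] (S : LinearDPPE n K)

/-- If no nonzero syzygy is supported on the set `W` of derivatives, the implicit ideal contains
no nonzero polynomial in these derivatives. -/
theorem eq_zero_of_vars_subset (W : Set (Fin n × ℕ))
    (hW : ∀ F : Fin n → DiffOp K, IsSyzygy S.operators F → (∀ i k, (i, k) ∉ W → F i k = 0) → F = 0)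
    {f : DiffPoly (Fin n) K} (hf : f ∈ S.implicitIdeal) (hfW : (f.vars : Set (Fin n × ℕ)) ⊆ W) :
    f = 0 := by
  classical
  obtain ⟨g, rfl⟩ := exists_rename_eq_of_vars_subset_range f ((↑) : W → Fin n × ℕ)
    Subtype.val_injective (by rwa [Subtype.range_coe])
  choose b t hbt using fun v : Fin n × ℕ => exists_eq_C_add_linearForm
    (iterDeriv_mem_affineForms (affineForms_mono (Set.subset_univ _)
      (mem_affineForms_of_totalDegree_le (S.totalDegree_le v.1))) v.2)
  have hind : LinearIndependent K fun w : W => t w := by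
    rw [linearIndependent_iff]
    intro l hl
    set l' : Fin n × ℕ →₀ K := l.mapDomain (↑) with hl'
    have hl'0 : Finsupp.linearCombination K t l' = 0 := by
      rw [hl', Finsupp.linearCombination_mapDomain]
      exact hl
    -- Grouped by the index $i$, a linear relation among the linear parts of the $\partial^k P_i$
    -- with $(i,k) \in W$ becomes a family of operators: a syzygy supported on `W`.
    have hF := hW l'.curry (S.isSyzygy_of_coeff_eq_zero _ fun v => ?_) fun i k hik => ?_
    · refine Finsupp.ext fun w => ?_
      have := DFunLike.congr_fun (congrFun hF w.1.1) w.1.2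
      rwa [Finsupp.curry_apply, hl', Finsupp.mapDomain_apply Subtype.val_injective l w] at this
    · have hsum : ∑ i, act (l'.curry i) (S.P i)
          = l'.sum fun w c => C c * iterDeriv w.2 (S.P w.1) := by
        rw [← Finsupp.sum_curry_index l' (fun i k c => C c * iterDeriv k (S.P i)),
          Finsupp.sum_fintype]
        · rfl
        · exact fun _ => Finsupp.sum_zero_index
      have hv := DFunLike.congr_fun hl'0 v
      rw [Finsupp.linearCombination_apply, Finsupp.sum_apply, Finsupp.zero_apply] at hv
      rw [hsum, Finsupp.sum, coeff_sum, ← hv]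
      refine Finset.sum_congr rfl fun w _ => ?_
      rw [coeff_C_mul, hbt, coeff_add, coeff_single_C, zero_add, coeff_linearForm]
      rfl
    · rw [Finsupp.curry_apply]
      exact Finsupp.mapDomain_of_notMem_range _ _ (by rwa [Subtype.range_coe])
  have hinj := aeval_injective_of_linearIndependent (fun w : W => b w) (fun w => t w) hind
  have hg : aeval (fun w : W => C (b w) + linearForm _ K (t w)) g = 0 := by
    rw [mem_implicitIdeal, subst, aeval_rename] at hf
    rw [← hf]
    congr 2
    funext w
    exact (hbt w).symm
  rw [hinj (hg.trans (map_zero _).symm), map_zero]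

/-- A primitive linear element of the implicit ideal is a characteristic polynomial if the leading
matrix has full rank. -/
theorem isCharPoly_of_isPrimitivePart (hS : S.leadingMatrix.rank = n - 1)
    {A B : DiffPoly (Fin n) K} (hB : B ∈ S.implicitIdeal) (hB0 : B ≠ 0)
    (hA : S.IsPrimitivePart B A) :
    CharSet.HasDimension S.implicitIdeal (n - 1) ∧ CharSet.IsCharPoly S.implicitIdeal A := by
  obtain ⟨FF, LL, P, rfl, hgcd, hFL, rfl⟩ := hA
  change S.linearPoly FF ∈ _ at hB
  change S.linearPoly FF ≠ 0 at hB0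
  change _ ∧ CharSet.IsCharPoly _ (S.linearPoly LL)
  have hFF : FF ≠ 0 := by
    rintro rfl
    exact hB0 S.linearPoly_zero
  have hP : P ≠ 0 := by
    rintro rfl
    exact hFF (funext fun i => by rw [hFL, DiffOp.zero_mul, Pi.zero_apply])
  have hLL0 : LL ≠ 0 := by
    rintro rfl
    exact hFF (funext fun i => by rw [hFL, Pi.zero_apply, DiffOp.mul_zero])
  have hLL : IsSyzygy S.operators LL := by
    rw [← isSyzygy_mul_iff _ _ hP, ← funext hFL]
    exact (S.linearPoly_mem_implicitIdeal FF).mp hB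
  obtain ⟨i₁, hi₁⟩ := S.exists_row S.P_pos hS
  have hdeg := S.totalDegree_linearPoly_le LL
  refine CharSet.IsMinimalIn.hasDimension_and_isCharPoly S.P_pos ?_ hdeg ?_
    ((S.linearPoly_mem_implicitIdeal LL).mpr hLL)
  · intro v hv _ f hf hfv
    have hd := coeff_single_ne_zero_of_mem_vars hdeg hv
    rw [coeff_linearPoly] at hd
    -- The set leaves out `v` and its derivatives. A syzygy supported on it has, in component `v.1`,
    -- order below `v.2`, where `LL` has a nonzero coefficient.
    refine S.eq_zero_of_vars_subset {w | w.1 = v.1 → w.2 < v.2} (fun F hF h0 => ?_) hf ?_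
    · exact IsSyzygy.eq_zero_of_lt hi₁ hgcd hFL hP hLL hd hF fun k hk =>
        h0 _ _ fun h => absurd (h rfl) (not_lt.mpr hk)
    · rintro ⟨i, k⟩ hw rfl
      exact not_le.mp fun h => hfv k h hw
  · rintro ⟨b, hb⟩
    refine hLL0 (funext fun i => Finsupp.ext fun k => ?_)
    rw [← S.coeff_linearPoly LL (i, k), ← hb, coeff_single_C]
    rfl

end LinearDPPE

/-! ### The differential resultant vanishes on the common zeros -/

namespace DiffRes

open MvPolynomial DiffPoly

/-- The one index beyond the end of the list stands for the last column of the resultant matrix,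
that of the terms free of $U$. -/
theorem sum_getElem?_elim {α T : Type*} [AddCommMonoid T] (φ : α → T) (c : T) (l : List α) :
    ∑ b : Fin (l.length + 1), (l[(b : ℕ)]?).elim c φ = (l.map φ).sum + c := by
  induction l with
  | nil => simp
  | cons a l ih =>
    rw [List.length_cons, Fin.sum_univ_succ]
    simp only [Fin.val_succ, List.getElem?_cons_succ, ih]
    simp [add_assoc]

/-- Each differentiation raises both sides of the order bound by one. For $k \le N - o_i - \gamma$
it keeps all variables of $\partial^k f_i$ inside $\mathcal V$. -/
theorem iterDeriv_mem_affineForms {n r : ℕ} {R : Type*} [CommRing R] [Differential R]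
    (f : Fin n → DiffPoly (Fin r) R) {i : Fin n} (hf : (f i).totalDegree ≤ 1) (k : ℕ) :
    iterDeriv k (f i) ∈ affineForms R
      {v : Fin r × ℕ | v.2 + gammaAt f v.1 ≤ order (f i) + k} := by
  induction k with
  | zero =>
    exact affineForms_mono (fun v hv => add_gammaAt_le f hv)
      (mem_affineForms_of_totalDegree_le hf)
  | succ k ih =>
    rw [iterDeriv_succ]
    refine deriv_mem_affineForms (fun v hv => ?_) (fun v hv => ?_) ih
    all_goals
      simp only [Set.mem_ofPred_eq] at hv ⊢
      omega

theorem mem_varSet {n r : ℕ} {R : Type*} [CommRing R] (f : Fin n → DiffPoly (Fin r) R)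
    (v : ℕ ×ₗ Fin r) :
    v ∈ varSet f ↔ (ofLex v).1 + gammaAt f (ofLex v).2 + gamma f ≤ N f := by
  rw [varSet, Finset.mem_map]
  constructor
  · rintro ⟨w, hw, rfl⟩
    exact (Finset.mem_filter.mp hw).2
  · intro h
    exact ⟨ofLex v, Finset.mem_filter.mpr ⟨Finset.mem_product.mpr
      ⟨Finset.mem_range.mpr (by omega), Finset.mem_univ _⟩, h⟩, rfl⟩

/-- Each row of the resultant matrix collects the coefficients of an affine form, so that a
homomorphism killing `PS(f_1, …, f_n)` kills the resultant. -/
theorem map_cRes_eq_zero {n r : ℕ} {R T : Type*} [CommRing R] [Differential R] [CommRing T]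
    [IsDomain T] (f : Fin n → DiffPoly (Fin r) R) (hf : ∀ i, (f i).totalDegree ≤ 1)
    (Θ : DiffPoly (Fin r) R →+* T) (hΘ : ∀ i k, Θ (iterDeriv k (f i)) = 0) :
    Θ (C (cRes f)) = 0 := by
  classical
  rw [cRes]
  split_ifs with hcard
  swap
  · rw [map_zero, map_zero]
  have hlen : (varList f).length + 1 = L f := by rw [← hcard, varList, Finset.length_sort]
  let φ : ℕ ×ₗ Fin r → DiffPoly (Fin r) R := fun v => X ((ofLex v).2, (ofLex v).1)
  -- The values of the variables followed by a 1: the matrix maps this vector to the values of the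
  -- row polynomials, and the final 1 makes it nonzero.
  let vec : Fin (L f) → T := fun b => ((varList f)[(b : ℕ)]?).elim 1 fun v => Θ (φ v)
  change (Θ.comp C) (matrix f).det = 0
  rw [RingHom.map_det]
  refine Matrix.exists_mulVec_eq_zero_iff.mp ⟨vec, fun h => ?_, funext fun a => ?_⟩
  · have h1 := congrFun h ⟨(varList f).length, by omega⟩
    simp [vec] at h1
  · set ik := finSigmaFinEquiv.symm a with hik
    set g := iterDeriv (numRows f ik.1 - 1 - (ik.2 : ℕ)) (f ik.1) with hg
    have hrow : ∀ b, (Θ.comp C) (matrix f a b) * vec b =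
        ((varList f)[(b : ℕ)]?).elim (Θ (C (constantCoeff g)))
          fun v => Θ (C (varCoeff g (ofLex v).2 (ofLex v).1) * φ v) := by
      intro b
      change Θ (C (match (varList f)[(b : ℕ)]? with
        | some v => varCoeff g (ofLex v).2 (ofLex v).1
        | none => constantCoeff g)) * ((varList f)[(b : ℕ)]?).elim 1 (fun v => Θ (φ v)) = _
      cases (varList f)[(b : ℕ)]? with
      | none => exact mul_one _
      | some v => exact (map_mul Θ _ _).symm
    have hmem : g ∈ affineForms R ((((varSet f).image fun v => ((ofLex v).2, (ofLex v).1)) :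
        Finset (Fin r × ℕ)) : Set (Fin r × ℕ)) := by
      refine affineForms_mono (fun v hv => ?_) (iterDeriv_mem_affineForms f (hf ik.1) _)
      -- The existence of a row index makes `numRows` positive, so its truncated subtractions are
      -- genuine.
      have hk : (ik.2 : ℕ) < N f + 1 - order (f ik.1) - gamma f := ik.2.2
      have hv' : v.2 + gammaAt f v.1 ≤
        order (f ik.1) + (N f + 1 - order (f ik.1) - gamma f - 1 - (ik.2 : ℕ)) := hv
      refine Finset.mem_coe.mpr (Finset.mem_image.mpr ⟨toLex (v.2, v.1), ?_, rfl⟩)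
      rw [mem_varSet]
      change v.2 + gammaAt f v.1 + gamma f ≤ N f
      omega
    have hsum := eq_sum_of_mem_affineForms hmem
    rw [Finset.sum_image (by
      intro x _ y _ hxy
      have h1 := congrArg Prod.fst hxy
      have h2 := congrArg Prod.snd hxy
      exact Prod.ext h2 h1)] at hsum
    have hnodup : (varList f).Nodup := Finset.sort_nodup _ _
    have htoFinset : (varList f).toFinset = varSet f := Finset.sort_toFinset _ _
    calc ((Θ.comp C).mapMatrix (matrix f)).mulVec vec a
        = ∑ b : Fin (L f), ((varList f)[(b : ℕ)]?).elim (Θ (C (constantCoeff g)))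
          fun v => Θ (C (varCoeff g (ofLex v).2 (ofLex v).1) * φ v) := by
          rw [Matrix.mulVec, dotProduct]
          exact Finset.sum_congr rfl fun b _ => hrow b
      _ = ∑ b : Fin ((varList f).length + 1),
          ((varList f)[(b : ℕ)]?).elim (Θ (C (constantCoeff g)))
          fun v => Θ (C (varCoeff g (ofLex v).2 (ofLex v).1) * φ v) := by rw [hlen]
      _ = Θ g := by
        rw [sum_getElem?_elim, ← List.sum_toFinset _ hnodup, htoFinset]
        conv_rhs => rw [hsum]
        rw [map_add, map_sum, add_comm]
        rfl
      _ = 0 := hΘ _ _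

end DiffRes

/-! ### The perturbed substitution and the lowest coefficient of the resultant -/

namespace LinearDPPE

open MvPolynomial DiffPoly DiffRes

variable {n : ℕ} {K : Type*} [Field K]

theorem totalDegree_perturbedF_le (S : LinearDPPE n K) {φ : Fin n → DiffPoly (Fin (n - 1)) K}
    (hφ : ∀ i, (φ i).totalDegree ≤ 1) (i : Fin n) : (S.perturbedF φ i).totalDegree ≤ 1 := by
  have hF : (S.F i).totalDegree ≤ 1 := by
    refine (totalDegree_sub _ _).trans (max_le ?_ ?_)
    · rw [totalDegree_C]; exact zero_le_one
    · exact (totalDegree_map_le _ _).trans (S.totalDegree_le i)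
  refine (totalDegree_sub _ _).trans (max_le ((totalDegree_map_le _ _).trans hF) ?_)
  refine (totalDegree_mul _ _).trans ?_
  rw [totalDegree_C, zero_add]
  exact (totalDegree_map_le _ _).trans (hφ i)

variable [Differential K] (S : LinearDPPE n K) (φ : Fin n → DiffPoly (Fin (n - 1)) K)

/-- The substitution `x_i ↦ P_i(U) + p φ_i(U)` on `K{X}`. -/
noncomputable def perturbedSubst :
    DiffPoly (Fin n) K →+* Polynomial (DiffPoly (Fin (n - 1)) K) :=
  eval₂Hom (Polynomial.C.comp C) fun v : Fin n × ℕ =>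
    iterDeriv v.2 (Polynomial.C (S.P v.1) + Polynomial.X * Polynomial.C (φ v.1))

/-- The substitution `x_i ↦ P_i(U) + p φ_i(U)` on `K{X}[p]`. -/
noncomputable def perturbedSubstPoly :
    Polynomial (DiffPoly (Fin n) K) →+* Polynomial (DiffPoly (Fin (n - 1)) K) :=
  Polynomial.eval₂RingHom (S.perturbedSubst φ) Polynomial.X

/-- The substitution `x_i ↦ P_i(U) + p φ_i(U)` on `K{X}[p]{U}`. -/
noncomputable def perturbedEval :
    DiffPoly (Fin (n - 1)) (Polynomial (DiffPoly (Fin n) K)) →+*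
      Polynomial (DiffPoly (Fin (n - 1)) K) :=
  eval₂Hom (S.perturbedSubstPoly φ) fun v => Polynomial.C (X v)

theorem perturbedSubst_C (a : K) : S.perturbedSubst φ (C a) = Polynomial.C (C a) :=
  eval₂Hom_C _ _ _

theorem perturbedSubst_X (v : Fin n × ℕ) : S.perturbedSubst φ (X v) =
    iterDeriv v.2 (Polynomial.C (S.P v.1) + Polynomial.X * Polynomial.C (φ v.1)) :=
  eval₂Hom_X' _ _ _

theorem perturbedSubstPoly_C (f : DiffPoly (Fin n) K) :
    S.perturbedSubstPoly φ (Polynomial.C f) = S.perturbedSubst φ f :=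
  Polynomial.eval₂_C _ _

theorem perturbedSubstPoly_X : S.perturbedSubstPoly φ Polynomial.X = Polynomial.X :=
  Polynomial.eval₂_X _ _

theorem perturbedEval_C (f : Polynomial (DiffPoly (Fin n) K)) :
    S.perturbedEval φ (C f) = S.perturbedSubstPoly φ f :=
  eval₂Hom_C _ _ _

theorem perturbedEval_X (v : Fin (n - 1) × ℕ) : S.perturbedEval φ (X v) = Polynomial.C (X v) :=
  eval₂Hom_X' _ _ _

/-- Checked on the generators of each layer $U$, $p$, $X$, $\mathbb K$; for $p$ it uses $\partial p
= 0$ on both sides. It reduces the vanishing of all $\partial^k F_i^\phi$ to that of $F_i^\phi$. -/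
theorem perturbedEval_deriv (f : DiffPoly (Fin (n - 1)) (Polynomial (DiffPoly (Fin n) K))) :
    S.perturbedEval φ (f′) = (S.perturbedEval φ f)′ := by
  refine map_deriv_of_C_of_X _ (fun g => ?_) (fun v => ?_) f
  · rw [perturbedEval_C, perturbedEval_C]
    refine polynomial_map_deriv _ (fun h => ?_) ?_ g
    · rw [perturbedSubstPoly_C, perturbedSubstPoly_C]
      refine map_deriv_of_C_of_X _ (fun a => ?_) (fun v => ?_) h
      · rw [perturbedSubst_C, perturbedSubst_C, polynomial_deriv_C, deriv_C]
      · rw [perturbedSubst_X, perturbedSubst_X, iterDeriv_succ]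
    · rw [perturbedSubstPoly_X, polynomial_deriv_X]
  · rw [perturbedEval_X, perturbedEval_X, polynomial_deriv_C, deriv_X]

theorem perturbedEval_map (f : DiffPoly (Fin (n - 1)) K) :
    S.perturbedEval φ (map (Polynomial.C.comp C) f) = Polynomial.C f := by
  have h : ((S.perturbedEval φ).comp (map (Polynomial.C.comp C))) = Polynomial.C := by
    refine MvPolynomial.ringHom_ext (fun a => ?_) fun v => ?_
    · rw [RingHom.comp_apply, map_C, perturbedEval_C, RingHom.comp_apply, perturbedSubstPoly_C,
        perturbedSubst_C]
    · rw [RingHom.comp_apply, map_X, perturbedEval_X]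
  exact RingHom.congr_fun h f

theorem perturbedEval_perturbedF (i : Fin n) : S.perturbedEval φ (S.perturbedF φ i) = 0 := by
  rw [perturbedF, F, map_sub (map _), map_map, map_C, map_sub, map_sub, map_mul, perturbedEval_map,
    perturbedEval_map, perturbedEval_C, perturbedEval_C, perturbedSubstPoly_C,
    perturbedSubstPoly_X, perturbedSubst_X, iterDeriv_zero]
  ring

theorem perturbedSubstPoly_perturbedRes (hφ : ∀ i, (φ i).totalDegree ≤ 1) :
    S.perturbedSubstPoly φ (S.perturbedRes φ) = 0 := by
  rw [← perturbedEval_C]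
  refine map_cRes_eq_zero _ (S.totalDegree_perturbedF_le hφ) _ fun i k => ?_
  rw [iterDeriv_map _ (S.perturbedEval_deriv φ), perturbedEval_perturbedF, iterDeriv_zero_right]

/-- Setting $p = 0$ turns the perturbed substitution into the original one; the derivation of $R[p]$
acts coefficientwise, so taking the constant coefficient commutes with it. -/
theorem constantCoeff_perturbedSubstPoly (f : Polynomial (DiffPoly (Fin n) K)) :
    (S.perturbedSubstPoly φ f).coeff 0 = S.subst (f.coeff 0) := by
  have h : Polynomial.constantCoeff.comp (S.perturbedSubstPoly φ) =
      S.subst.toRingHom.comp Polynomial.constantCoeff := by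
    refine Polynomial.ringHom_ext (fun g => ?_) ?_
    · have hg : Polynomial.constantCoeff.comp (S.perturbedSubst φ) = S.subst.toRingHom := by
        refine MvPolynomial.ringHom_ext (fun a => ?_) fun v => ?_
        · rw [RingHom.comp_apply, perturbedSubst_C, Polynomial.constantCoeff_apply,
            Polynomial.coeff_C_zero]
          exact (algHom_C S.subst a).symm
        · rw [RingHom.comp_apply, perturbedSubst_X, iterDeriv_map Polynomial.constantCoeff
            fun f => Differential.coeff_mapCoeffs f 0]
          change _ = S.subst (X v)
          rw [subst, aeval_X]
          simp
      rw [RingHom.comp_apply, perturbedSubstPoly_C, RingHom.comp_apply,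
        Polynomial.constantCoeff_apply (Polynomial.C g), Polynomial.coeff_C_zero, ← hg]
      rfl
    · rw [RingHom.comp_apply, perturbedSubstPoly_X, RingHom.comp_apply]
      simp
  exact RingHom.congr_fun h f

theorem perturbedRes_ne_zero (hD : 0 ≤ S.degree φ) : S.perturbedRes φ ≠ 0 := by
  intro h
  rw [degree, if_pos h] at hD
  omega

theorem lowestCoeff_eq (hD : 0 ≤ S.degree φ) :
    S.lowestCoeff φ = (S.perturbedRes φ).trailingCoeff := by
  rw [lowestCoeff, degree, if_neg (S.perturbedRes_ne_zero φ hD), Int.toNat_natCast]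
  rfl

theorem lowestCoeff_ne_zero (hD : 0 ≤ S.degree φ) : S.lowestCoeff φ ≠ 0 := by
  rw [lowestCoeff_eq S φ hD, Ne, Polynomial.trailingCoeff_eq_zero]
  exact S.perturbedRes_ne_zero φ hD

/-- Write the resultant as $p^{D_\phi} Q$. The substitution fixes $p$ and has values in a domain, so
it kills $Q$, and $p = 0$ gives the claim for $Q(0) = A_{D_\phi}$. -/
theorem lowestCoeff_mem_implicitIdeal (hφ : ∀ i, (φ i).totalDegree ≤ 1) (hD : 0 ≤ S.degree φ) :
    S.lowestCoeff φ ∈ S.implicitIdeal := by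
  obtain ⟨Q, hQ⟩ := (Polynomial.X_pow_dvd_iff (f := S.perturbedRes φ)
    (n := (S.perturbedRes φ).natTrailingDegree)).mpr
    fun d hd => Polynomial.coeff_eq_zero_of_lt_natTrailingDegree hd
  have h0 : S.lowestCoeff φ = Q.coeff 0 := by
    rw [lowestCoeff_eq S φ hD, Polynomial.trailingCoeff]
    conv_lhs => rw [hQ]
    rw [Polynomial.coeff_X_pow_mul', ← hQ, if_pos le_rfl, Nat.sub_self]
  have hz := S.perturbedSubstPoly_perturbedRes φ hφ
  rw [hQ, map_mul, map_pow, perturbedSubstPoly_X] at hz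
  have hQ0 := (mul_eq_zero.mp hz).resolve_left (pow_ne_zero _ Polynomial.X_ne_zero)
  rw [mem_implicitIdeal, h0, ← S.constantCoeff_perturbedSubstPoly φ, hQ0, Polynomial.coeff_zero]

end LinearDPPE

theorem mainTheorem9 {K : Type*} [Field K] [Differential K] (n : ℕ) (P : LinearDPPE n K)
    (φ : Fin n → DiffPoly (Fin (n - 1)) K) (hφ : ∀ i, (φ i).totalDegree ≤ 1)
    (hD : 0 ≤ P.degree φ)
    (A : DiffPoly (Fin n) K) (hA : P.IsAssociated φ A)
    (c : ℕ) (hc : P.IsCoOrder A c)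
    (hS : P.leadingMatrix.rank = n - 1) (hDc : P.degree φ = (c : ℤ)) :
    CharSet.HasDimension P.implicitIdeal (n - 1) ∧
      CharSet.IsCharPoly P.implicitIdeal A := by
  exact P.isCharPoly_of_isPrimitivePart hS (P.lowestCoeff_mem_implicitIdeal φ hφ hD)
    (P.lowestCoeff_ne_zero φ hD) hA
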